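/- Let $w_1,\dots,w_k$ be contracting similarities of $\mathbb R^N$, $\|w_i(x)-w_i(y)\|=\lambda_i\|x-y\|$ with $0<\lambda_i<1$, and let $K$ be the nonempty compact set with $K=\bigcup_i w_i(K)$. Let $p_i$ be the fixed point of $w_i$. Call $p_i$ essential if $w_j(p_i)=w_{j'}(p_{i'})$ for some $j,j'$ and some $i'\ne i$. Let $V_0$ be the set of essential fixed points and $E_0=\{(p,q):p,q\in V_0,\ p\neq q\}$. For a word $\sigma$ of length $|\sigma|=n$ put $w_\sigma=w_{\sigma(1)}\circ\dots\circ w_{\sigma(n)}$, and call $w_\sigma(V_0)$ a combinatorial $n$-cell. Let $V_1=\bigcup_i w_i(V_0)$ and $E_1=\{(w_i(p),w_i(q)):(p,q)\in E_0,\ 1\le i\le k\}$. Assume that $K$ is a nested fractal, that is, $V_0$ has at least two points and: 1. $\lambda_i=\lambda$ for all $i$. 2. There is a nonempty bounded open set $U$ with $\bigcup_i w_i(U)\subset U$ and the sets $w_i(U)$ pairwise disjoint. 3. The graph $(V_1,E_1)$ is connected. 4. For distinct words $\sigma,\sigma'$ of the same length, $w_\sigma(V_0)\ne w_{\sigma'}(V_0)$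 and $w_\sigma(K)\cap w_{\sigma'}(K)=w_\sigma(V_0)\cap w_{\sigma'}(V_0)$. 5. For distinct $p,q\in V_0$ and every $n\ge0$, the reflection in $\{z:\|z-p\|=\|z-q\|\}$ maps combinatorial $n$-cells to combinatorial $n$-cells, and maps to itself each one with points strictly on both sides of this hyperplane. Let $\ell(e)=\|p-q\|$ for $e=(p,q)\in E_0$, and write $e^+=p$. On $\mathcal H=\bigoplus_\sigma \ell^2(E_0)$ (sum over all finite words) let $f\in C(K)$ act by multiplying the coordinate $(\sigma,e)$ by $f(w_\sigma(e^+))$. Let $D=\bigoplus_\sigma\lambda^{-|\sigma|}D_o$ be the self-adjoint operator for which $D_o$ maps the basis vector of $e=(p,q)$ to $\ell(e)^{-1}$ times that of $(q,p)$. Put $d=\log k/\log(1/\lambda)$. Then: (a) The metric dimension of the triple, i.e. the abscissa of convergence of $\mathcal Z(s)=\mathrm{tr}(|D|^{-s})$, is $d$. For $\operatorname{Re}s>d$ the operator $|D|^{-s}$ is trace class, and $\mathcal Z$ has the meromorphic extension to $\mathbb C$ $$\mathcal Z(s)=\frac{\sum_{e\in E_0}\ell(e)^s}{1-k\lambda^s}.$$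 (b) The dimension spectrum, i.e. the set of poles of this extension, is $$\Big\{z=d\Big(1+\frac{2\pi i n}{\log k}\Big): n\in\mathbb Z,\ \sum_{e\in E_0}\ell(e)^z\neq0\Big\}.$$ In particular it is the whole set $\{d(1+2\pi i n/\log k):n\in\mathbb Z\}$ if the numerator vanishes at none of these points, for example if all edges of $E_0$ have the same length. The pole at $d$ is simple. (c) $|D|^{-d}$ is compact and $S_n(|D|^{-d})/\log n$ is bounded, where $S_n(T)$ is the sum of the $n$ largest eigenvalues of $|T|$, counted with multiplicity. The $d$-dimensional Hausdorff measure of $K$ is positive and finite. Let $H_d$ be this measure on $K$, normalized so that $H_d(K)=1$. Let $\omega$ be any positive linear functional on bounded real sequences that extends the limit. Set $\mathrm{tr}_\omega(T)=\omega\big((S_n(T)/\log n)_n\big)$ for $T\ge0$, and extend it to general $T$ through the positive and negative parts of the real and imaginary parts of $T$. Then for all $f\in C(K)$ $$\oint f=\mathrm{tr}_\omega(f|D|^{-d})=\frac1{\log k}\sum_{e\in E_0}\ell(e)^d\int_K f\,dH_d .$$ Consequently the only finite Borel measure on $K$ that represents the functional $f\mapsto\oint f$ is $\frac1{\log k}\sum_{e\in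 E_0}\ell(e)^d\,H_d$. -/

import Mathlib

open scoped ENNReal MeasureTheory BoundedContinuousFunction ComplexStarModule

noncomputable section

/-! ### Operators on a Hilbert space -/

section Operators

universe u

variable {H : Type u} [NormedAddCommGroup H] [InnerProductSpace ℂ H] [CompleteSpace H]

/-- `B` is the (everywhere defined, bounded) inverse of the unbounded operator `D`:
the graph of `D` is `{(x, y) | x = B y}`. Such a `B` is unique. -/
def IsBoundedInverse (D : H →ₗ.[ℂ] H) (B : H →L[ℂ] H) : Prop :=
  ∀ p : H × H, p ∈ D.graph ↔ B p.2 = p.1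

open Classical in
/-- The bounded inverse of an invertible unbounded operator (and `0` if there is none). -/
def boundedInverse (D : H →ₗ.[ℂ] H) : H →L[ℂ] H :=
  if h : ∃ B, IsBoundedInverse D B then h.choose else 0

/-- `|D|^{-s}` for an invertible self-adjoint operator `D` and `Re s > 0`, by the continuous
functional calculus: the function `x ↦ x ^ s` applied to `|D|⁻¹ = |D⁻¹|`. -/
def absNegPow (D : H →ₗ.[ℂ] H) (s : ℂ) : H →L[ℂ] H :=
  cfc (fun z : ℂ => z ^ s) (CFC.abs (boundedInverse D))

/-- `T` is trace class: the trace of `|T|` is finite (in every orthonormal basis). -/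
def IsTraceClass (T : H →L[ℂ] H) : Prop :=
  ∀ (ι : Type u) (b : HilbertBasis ι ℂ H),
    Summable fun i => (inner ℂ (b i) (CFC.abs T (b i)) : ℂ)

/-- The trace of a trace class operator, computed in some orthonormal basis (for a trace class
operator the value does not depend on the basis). -/
def opTrace (T : H →L[ℂ] H) : ℂ :=
  ∑' i, inner ℂ ((exists_hilbertBasis ℂ H).choose_spec.choose i)
    (T ((exists_hilbertBasis ℂ H).choose_spec.choose i))

/-- The zeta function `s ↦ tr (|D|^{-s})`. -/
def zetaFun (D : H →ₗ.[ℂ] H) (s : ℂ) : ℂ := opTrace (absNegPow D s)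

/-- The metric dimension: the abscissa of convergence of the zeta function. -/
def metricDim (D : H →ₗ.[ℂ] H) : ℝ :=
  sInf {s : ℝ | 0 < s ∧ IsTraceClass (absNegPow D (s : ℂ))}

/-- `g` is a meromorphic extension to the whole plane of the zeta function, which is defined (by an
operator of trace class) on the half plane to the right of the abscissa of convergence. -/
def IsMeromorphicExtension (D : H →ₗ.[ℂ] H) (g : ℂ → ℂ) : Prop :=
  Meromorphic g ∧
    ∀ s : ℂ, metricDim D < s.re → IsTraceClass (absNegPow D s) ∧ zetaFun D s = g s

/-- The dimension spectrum: the poles of the meromorphic extension of the zeta function. -/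
def dimensionSpectrum (D : H →ₗ.[ℂ] H) : Set ℂ :=
  {z | ∃ g : ℂ → ℂ, IsMeromorphicExtension D g ∧ meromorphicOrderAt g z < 0}

/-- The `j`-th largest eigenvalue (`j = 0, 1, 2, …`), counted with multiplicity, of `|T|` for a
compact operator `T`: the least `t ≥ 0` such that at most `j` eigenvalues, counted with
multiplicity, exceed `t`. -/
def singVal (T : H →L[ℂ] H) (j : ℕ) : ℝ :=
  sInf {t : ℝ | 0 ≤ t ∧
    Module.rank ℂ
      (⨆ (r : ℝ) (_ : t < r), Module.End.eigenspace (CFC.abs T).toLinearMap (r : ℂ) :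
        Submodule ℂ H) ≤ j}

/-- `S_n(T)`: the sum of the `n` largest eigenvalues of `|T|`. -/
def singSum (T : H →L[ℂ] H) (n : ℕ) : ℝ := ∑ j ∈ Finset.range n, singVal T j

/-- The sequence `S_n(T) / log n` (with value `0` at `n = 0` and `n = 1`). -/
def logMean (T : H →L[ℂ] H) (n : ℕ) : ℝ := singSum T n / Real.log n

/-- The Macaev ideal `𝓛^{1,∞}`: compact operators for which `S_n(T) / log n` is bounded. -/
def InMacaevIdeal (T : H →L[ℂ] H) : Prop :=
  IsCompactOperator T ∧ ∃ C : ℝ, ∀ n, ‖logMean T n‖ ≤ C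

/-- A generalized limit `ω`: a positive linear functional on bounded real sequences that extends
the ordinary limit. Invariance under dilations may hold in addition. -/
structure GeneralizedLimit where
  toLin : (ℕ →ᵇ ℝ) →ₗ[ℝ] ℝ
  nonneg : ∀ a : ℕ →ᵇ ℝ, 0 ≤ a → 0 ≤ toLin a
  eq_limit : ∀ (a : ℕ →ᵇ ℝ) (L : ℝ), Filter.Tendsto a Filter.atTop (nhds L) → toLin a = L

open Classical in
/-- `lim_ω S_n(T) / log n`, for a positive operator `T` in the Macaev ideal. -/
def dixmierPos (ω : GeneralizedLimit) (T : H →L[ℂ] H) : ℝ :=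
  if h : ∃ C : ℝ, ∀ n, ‖logMean T n‖ ≤ C then
    ω.toLin (BoundedContinuousFunction.ofNormedAddCommGroupDiscrete (logMean T) h.choose
      h.choose_spec)
  else 0

/-- The Dixmier trace of an operator in the Macaev ideal, extended from positive operators through
`T = (Re T)⁺ - (Re T)⁻ + i ((Im T)⁺ - (Im T)⁻)`. -/
def dixmierTrace (ω : GeneralizedLimit) (T : H →L[ℂ] H) : ℂ :=
  ((dixmierPos ω ((ℜ T : H →L[ℂ] H)⁺) - dixmierPos ω ((ℜ T : H →L[ℂ] H)⁻) : ℝ) : ℂ) +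
    Complex.I *
      ((dixmierPos ω ((ℑ T : H →L[ℂ] H)⁺) - dixmierPos ω ((ℑ T : H →L[ℂ] H)⁻) : ℝ) : ℂ)

/-- The noncommutative integral `∮ a = tr_ω (a |D|^{-d})`, `d` the metric dimension. -/
def ncIntegral (D : H →ₗ.[ℂ] H) (ω : GeneralizedLimit) (a : H →L[ℂ] H) : ℂ :=
  dixmierTrace ω (a * absNegPow D (metricDim D : ℂ))

end Operators

/-! ### Self-similar and nested fractals -/

/-- The self-similar fractal `K` of `k` contracting similarities `w i` of `ℝ^N`. -/
structure SelfSimilarFractal (N k : ℕ) where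
  w : Fin k → EuclideanSpace ℝ (Fin N) → EuclideanSpace ℝ (Fin N)
  ratio : Fin k → ℝ
  ratio_pos : ∀ i, 0 < ratio i
  ratio_lt_one : ∀ i, ratio i < 1
  dist_w : ∀ i x y, dist (w i x) (w i y) = ratio i * dist x y
  K : Set (EuclideanSpace ℝ (Fin N))
  nonempty_K : K.Nonempty
  isCompact_K : IsCompact K
  K_eq : K = ⋃ i, w i '' K

namespace SelfSimilarFractal

variable {N k : ℕ} (F : SelfSimilarFractal N k)

/-- `w_σ = w_{σ(1)} ∘ ⋯ ∘ w_{σ(n)}`; words of length `n` are lists of length `n`. -/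
def wWord : List (Fin k) → EuclideanSpace ℝ (Fin N) → EuclideanSpace ℝ (Fin N)
  | [] => id
  | i :: σ => F.w i ∘ wWord σ

/-- `λ_σ = λ_{σ(1)} ⋯ λ_{σ(n)}`. -/
def ratioWord (σ : List (Fin k)) : ℝ := (σ.map F.ratio).prod

/-- The set `V₀` of essential fixed points. -/
def V₀ : Set (EuclideanSpace ℝ (Fin N)) :=
  {p | ∃ i, F.w i p = p ∧ ∃ i' j j' p', i' ≠ i ∧ F.w i' p' = p' ∧ F.w j p = F.w j' p'}

/-- The combinatorial cell `w_σ(V₀)`. -/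
def cell (σ : List (Fin k)) : Set (EuclideanSpace ℝ (Fin N)) := F.wWord σ '' F.V₀

/-- The vertex set `V_n`. -/
def V (n : ℕ) : Set (EuclideanSpace ℝ (Fin N)) :=
  {x | ∃ σ : List (Fin k), σ.length = n ∧ x ∈ F.cell σ}

/-- `(x, y) ∈ E_n`. -/
def IsEdge (n : ℕ) (x y : EuclideanSpace ℝ (Fin N)) : Prop :=
  ∃ σ : List (Fin k), σ.length = n ∧
    ∃ p ∈ F.V₀, ∃ q ∈ F.V₀, p ≠ q ∧ F.wWord σ p = x ∧ F.wWord σ q = y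

/-- The reflection in the hyperplane of points equidistant from `p` and `q`. -/
def mirror (p q : EuclideanSpace ℝ (Fin N)) :
    EuclideanSpace ℝ (Fin N) → EuclideanSpace ℝ (Fin N) :=
  haveI : Nonempty (AffineSubspace.perpBisector p q) :=
    AffineSubspace.perpBisector_nonempty.to_subtype
  EuclideanGeometry.reflection (AffineSubspace.perpBisector p q)

/-- `(K, {w_i})` is a nested fractal with scaling parameter `lam`. -/
structure IsNested (lam : ℝ) : Prop where
  nontrivial_V₀ : F.V₀.Nontrivial
  ratio_eq : ∀ i, F.ratio i = lam
  open_set_condition : ∃ U : Set (EuclideanSpace ℝ (Fin N)),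
    IsOpen U ∧ Bornology.IsBounded U ∧ U.Nonempty ∧ (∀ i, F.w i '' U ⊆ U) ∧
      ∀ i j, i ≠ j → Disjoint (F.w i '' U) (F.w j '' U)
  connected : ∀ x ∈ F.V 1, ∀ y ∈ F.V 1, Relation.ReflTransGen (F.IsEdge 1) x y
  nesting : ∀ σ τ : List (Fin k), σ.length = τ.length → σ ≠ τ →
    F.cell σ ≠ F.cell τ ∧
      (F.wWord σ '' F.K) ∩ (F.wWord τ '' F.K) = F.cell σ ∩ F.cell τ
  symmetry : ∀ p ∈ F.V₀, ∀ q ∈ F.V₀, p ≠ q → ∀ σ : List (Fin k),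
    (∃ τ : List (Fin k), τ.length = σ.length ∧ mirror p q '' F.cell σ = F.cell τ) ∧
      ((∃ x ∈ F.cell σ, ∃ y ∈ F.cell σ, dist x p < dist x q ∧ dist y q < dist y p) →
        mirror p q '' F.cell σ = F.cell σ)

/-- The oriented edges `e = (e⁺, e⁻) ∈ E₀`. -/
def Edge : Type :=
  {e : EuclideanSpace ℝ (Fin N) × EuclideanSpace ℝ (Fin N) //
    e.1 ∈ F.V₀ ∧ e.2 ∈ F.V₀ ∧ e.1 ≠ e.2}

variable {F}

/-- The edge with the opposite orientation. -/
def Edge.rev (e : F.Edge) : F.Edge :=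
  ⟨(e.1.2, e.1.1), e.2.2.1, e.2.1, e.2.2.2.symm⟩

/-- The (Euclidean) length of an edge. -/
def Edge.len (e : F.Edge) : ℝ := dist e.1.1 e.1.2

variable (F)

theorem fixedPoint_unique {i : Fin k} {p q : EuclideanSpace ℝ (Fin N)}
    (hp : F.w i p = p) (hq : F.w i q = q) : p = q := by
  have h := F.dist_w i p q
  rw [hp, hq] at h
  have h1 := F.ratio_lt_one i
  have h2 : 0 ≤ dist p q := dist_nonneg
  exact dist_eq_zero.1 (by nlinarith)

theorem finite_V₀ : F.V₀.Finite := by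
  have h : F.V₀ ⊆ ⋃ i, {p | F.w i p = p} := by
    rintro p ⟨i, hi, -⟩
    exact Set.mem_iUnion.2 ⟨i, hi⟩
  refine (Set.finite_iUnion fun i => ?_).subset h
  exact Set.Subsingleton.finite fun p hp q hq => F.fixedPoint_unique hp hq

instance : Finite F.Edge := by
  have : Finite F.V₀ := F.finite_V₀
  refine Finite.of_injective (β := F.V₀ × F.V₀)
    (fun e => (⟨e.1.1, e.2.1⟩, ⟨e.1.2, e.2.2.1⟩)) ?_
  intro a b h
  simp only [Prod.mk.injEq, Subtype.mk.injEq] at h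
  exact Subtype.ext (Prod.ext h.1 h.2)

instance : Fintype F.Edge := Fintype.ofFinite _

theorem w_mem {i : Fin k} {x : EuclideanSpace ℝ (Fin N)} (hx : x ∈ F.K) : F.w i x ∈ F.K := by
  rw [F.K_eq]
  exact Set.mem_iUnion.2 ⟨i, x, hx, rfl⟩

theorem wWord_mem (σ : List (Fin k)) {x : EuclideanSpace ℝ (Fin N)} (hx : x ∈ F.K) :
    F.wWord σ x ∈ F.K := by
  induction σ with
  | nil => exact hx
  | cons i σ ih => exact F.w_mem ih

theorem V₀_subset : F.V₀ ⊆ F.K := by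
  rintro p ⟨i, hi, -⟩
  obtain ⟨x, hx⟩ := F.nonempty_K
  have hd : ∀ n : ℕ, dist ((F.w i)^[n] x) p = F.ratio i ^ n * dist x p := by
    intro n
    induction n with
    | zero => simp
    | succ n ih =>
      rw [Function.iterate_succ_apply']
      nth_rewrite 1 [← hi]
      rw [F.dist_w, ih, pow_succ]
      ring
  have hm : ∀ n : ℕ, (F.w i)^[n] x ∈ F.K := by
    intro n
    induction n with
    | zero => exact hx
    | succ n ih =>
      rw [Function.iterate_succ_apply']
      exact F.w_mem ih
  refine F.isCompact_K.isClosed.mem_of_tendsto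
    (b := Filter.atTop) (f := fun n : ℕ => (F.w i)^[n] x) ?_ (Filter.Eventually.of_forall hm)
  rw [tendsto_iff_dist_tendsto_zero]
  simp only [hd]
  simpa using (tendsto_pow_atTop_nhds_zero_of_lt_one (F.ratio_pos i).le
    (F.ratio_lt_one i)).mul_const (dist x p)

/-! ### The discrete spectral triple -/

/-- The oriented edges of all levels: `(σ, e)` labels the copy of `e ∈ E₀` in the `σ`-summand. -/
abbrev Index : Type := List (Fin k) × F.Edge

/-- The Hilbert space `⊕_σ ⊕_{e ∈ E₀} ℂ`. -/
abbrev Hilb : Type := lp (fun _ : F.Index => ℂ) 2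

/-- The length `λ_σ ℓ(e)` of the edge `(σ, e)`. -/
def indexLen (x : F.Index) : ℝ := F.ratioWord x.1 * x.2.len

/-- The point `w_σ(e⁺)` of `K`. -/
def indexPoint (x : F.Index) : F.K :=
  ⟨F.wWord x.1 x.2.1.1, F.wWord_mem x.1 (F.V₀_subset x.2.2.1)⟩

/-- The Dirac operator `D = ⊕_σ λ_σ⁻¹ D_o`, where `D_o = F_o |D_o|` sends an oriented edge `e` to
`ℓ(e)⁻¹` times the edge with the opposite orientation, with its maximal domain. -/
def dirac : F.Hilb →ₗ.[ℂ] F.Hilb where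
  domain :=
    { carrier := {ξ | Memℓp (fun x : F.Index =>
        (((F.indexLen x)⁻¹ : ℝ) : ℂ) * ξ (x.1, x.2.rev)) 2}
      add_mem' := by
        intro a b ha hb
        have h := Memℓp.add ha hb
        refine (congrArg (fun f => Memℓp f 2) ?_).mp h
        funext x
        simp [mul_add]
      zero_mem' := by
        refine (congrArg (fun f => Memℓp f 2) ?_).mp (zero_memℓp (E := fun _ : F.Index => ℂ))
        funext x
        simp
      smul_mem' := by
        intro c a ha
        have h := Memℓp.const_smul ha c
        refine (congrArg (fun f => Memℓp f 2) ?_).mp h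
        funext x
        simp [mul_left_comm] }
  toFun :=
    { toFun := fun ξ => ⟨fun x : F.Index =>
        (((F.indexLen x)⁻¹ : ℝ) : ℂ) * (ξ : F.Hilb) (x.1, x.2.rev), ξ.2⟩
      map_add' := by
        intro a b
        ext x
        exact mul_add _ _ _
      map_smul' := by
        intro c a
        ext x
        simp [mul_left_comm] }

theorem memℓp_mul (f : C(F.K, ℂ)) (ξ : F.Hilb) :
    Memℓp (fun x : F.Index => f (F.indexPoint x) * ξ x) 2 := by
  have : CompactSpace F.K := isCompact_iff_compactSpace.1 F.isCompact_K
  refine Memℓp.mono' (Memℓp.const_smul (lp.memℓp ξ) (‖f‖ : ℂ)) fun x => ?_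
  simp only [norm_mul, Pi.smul_apply, smul_eq_mul, Complex.norm_real, norm_norm]
  exact mul_le_mul_of_nonneg_right (f.norm_coe_le_norm _) (norm_nonneg _)

/-- The representation of `C(K)`: `π(f)` multiplies the coordinate `(σ, e)` by `f(w_σ(e⁺))`. -/
def rep (f : C(F.K, ℂ)) : F.Hilb →L[ℂ] F.Hilb :=
  haveI : CompactSpace F.K := isCompact_iff_compactSpace.1 F.isCompact_K
  LinearMap.mkContinuous
    { toFun := fun ξ => ⟨fun x : F.Index => f (F.indexPoint x) * ξ x, F.memℓp_mul f ξ⟩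
      map_add' := by
        intro a b
        ext x
        exact mul_add _ _ _
      map_smul' := by
        intro c a
        ext x
        simp [mul_left_comm] } ‖f‖ (by
      intro ξ
      have h := lp.norm_mono (p := 2) two_ne_zero
        (x := (⟨fun x : F.Index => f (F.indexPoint x) * ξ x, F.memℓp_mul f ξ⟩ : F.Hilb))
        (y := (‖f‖ : ℂ) • ξ) (fun x => by
          simp only [norm_mul, lp.coeFn_smul, Pi.smul_apply, smul_eq_mul, Complex.norm_real,
            norm_norm]
          exact mul_le_mul_of_nonneg_right (f.norm_coe_le_norm _) (norm_nonneg _))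
      refine h.trans ?_
      rw [norm_smul]
      simp)

/-- The numerator `∑_{e ∈ E₀} ℓ(e)^s`. -/
def edgeSum (s : ℂ) : ℂ := ∑ e : F.Edge, (e.len : ℂ) ^ s

/-- The Hausdorff measure `H_d` on `K`, normalized to total mass `1`. -/
def normalizedHausdorff (d : ℝ) : MeasureTheory.Measure F.K :=
  (MeasureTheory.Measure.hausdorffMeasure d F.K)⁻¹ •
    MeasureTheory.Measure.comap Subtype.val
      (MeasureTheory.Measure.hausdorffMeasure d :
        MeasureTheory.Measure (EuclideanSpace ℝ (Fin N)))

end SelfSimilarFractal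

end

/-! In the basis indexed by the edges (σ, e), D⁻¹ reverses the orientation and multiplies by the
length λ^|σ| ℓ(e). Reversal preserves length, so |D|^{-s} is diagonal with entries (λ^|σ| ℓ(e))^s,
and π(f) is diagonal as well. All operator statements thus become statements about families of
numbers; the `IsDiag` lemmas carry modulus, functional calculus, trace, compactness and singular
values over to the entries.

Zeta function: there are k^n words of length n, so the trace is ∑ ℓ(e)^s times a geometric series of
ratio kλ^s, absolutely convergent exactly when kλ^{Re s} < 1, that is Re s > d. The derivative of 1
- kλ^s vanishes nowhere, so its zeros are simple, and such a zero is a pole exactly when the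
numerator does not vanish there.

Dixmier trace: since λ^d = 1/k, the entries of π(g)|D|^{-d} on level m add up to the sum over e of
ℓ(e)^d times the average of g over the k^m points w_σ(e⁺). Cells of level m have equal H_d-measure,
shrink uniformly and overlap in finite sets, so these averages tend to ∫ g dH_d (`tendsto_average`),
and by Cesàro the sum over the levels below n, divided by n, has a limit. At most E k^n edges, E =
|E₀|, lie below level n, and all other entries are O(k^{-n}). For g ≥ 0 and E k^n ≤ M < E k^{n+1},
S_M therefore differs from that sum by O(1), while log M = n log k + O(1). So S_M / log M converges
and every ω returns its limit; a general f is split into four nonnegative parts.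

Hausdorff measure: covering K by its k^n cells bounds it above. Below, the mass distribution
principle applies to the image of the uniform Bernoulli measure, because the open set condition lets
a set of diameter λ^n meet only boundedly many cells of level n. -/

/-! ### Diagonal operators -/

section DiagonalOperators

universe u

variable {ι H : Type u} [NormedAddCommGroup H] [InnerProductSpace ℂ H]
  {b : HilbertBasis ι ℂ H}

/-- `T` multiplies the coordinate `x` with respect to the basis `b` by `a x`. -/
def IsDiag (b : HilbertBasis ι ℂ H) (T : H →L[ℂ] H) (a : ι → ℂ) : Prop :=
  ∀ (ξ : H) (x : ι), b.repr (T ξ) x = a x * b.repr ξ x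

theorem HilbertBasis.ext_repr (b : HilbertBasis ι ℂ H) {ξ η : H}
    (h : ∀ x, b.repr ξ x = b.repr η x) : ξ = η :=
  b.repr.injective (lp.ext (funext h))

theorem HilbertBasis.mem_span_image (b : HilbertBasis ι ℂ H) {S : Set ι} (hS : S.Finite) {ξ : H}
    (h : ∀ x ∉ S, b.repr ξ x = 0) : ξ ∈ Submodule.span ℂ (b '' S) := by
  have h0 : ∀ x ∉ hS.toFinset, b.repr ξ x • b x = 0 := by
    intro x hx
    rw [hS.mem_toFinset] at hx
    rw [h x hx, zero_smul]
  rw [(b.hasSum_repr ξ).unique (hasSum_sum_of_ne_finset_zero h0)]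
  refine Submodule.sum_mem _ fun x hx => Submodule.smul_mem _ _ (Submodule.subset_span ?_)
  exact ⟨x, hS.mem_toFinset.1 hx, rfl⟩

/-- Operator identities below are proved by comparing entries and citing this uniqueness. -/
theorem IsDiag.unique {T S : H →L[ℂ] H} {a : ι → ℂ} (hT : IsDiag b T a)
    (hS : IsDiag b S a) : T = S := by
  ext ξ
  refine b.ext_repr fun x => ?_
  rw [hT, hS]

theorem IsDiag.apply_basis {T : H →L[ℂ] H} {a : ι → ℂ} (hT : IsDiag b T a) (x : ι) :
    T (b x) = a x • b x := by
  classical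
  refine b.ext_repr fun y => ?_
  rw [hT, b.repr_self, map_smul, b.repr_self, lp.coeFn_smul, Pi.smul_apply, smul_eq_mul]
  by_cases h : y = x
  · rw [h]
  · rw [lp.single_apply_ne _ _ _ h, mul_zero, mul_zero]

theorem IsDiag.norm_le {T : H →L[ℂ] H} {a : ι → ℂ} (hT : IsDiag b T a) (x : ι) :
    ‖a x‖ ≤ ‖T‖ := by
  have h := T.le_opNorm (b x)
  rwa [hT.apply_basis, norm_smul, b.orthonormal.1 x, mul_one, mul_one] at h

theorem memℓp_two_mul {a : ι → ℂ} {C : ℝ} (ha : ∀ x, ‖a x‖ ≤ C) (ξ : lp (fun _ : ι => ℂ) 2) :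
    Memℓp (fun x => a x * ξ x) 2 := by
  refine Memℓp.mono' (Memℓp.const_smul (lp.memℓp ξ) (C : ℂ)) fun x => ?_
  simp only [norm_mul, Pi.smul_apply, smul_eq_mul, Complex.norm_real]
  exact mul_le_mul_of_nonneg_right ((ha x).trans (le_abs_self C)) (norm_nonneg _)

theorem exists_isDiag (b : HilbertBasis ι ℂ H) {a : ι → ℂ} {C : ℝ} (hC : 0 ≤ C)
    (ha : ∀ x, ‖a x‖ ≤ C) : ∃ T : H →L[ℂ] H, IsDiag b T a ∧ ‖T‖ ≤ C := by
  refine ⟨LinearMap.mkContinuous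
    { toFun := fun ξ => b.repr.symm ⟨fun x => a x * b.repr ξ x, memℓp_two_mul ha (b.repr ξ)⟩
      map_add' := by
        intro ξ η
        refine b.ext_repr fun x => ?_
        simp [mul_add]
        rfl
      map_smul' := by
        intro c ξ
        refine b.ext_repr fun x => ?_
        simp [mul_left_comm] } C ?_, fun ξ x => ?_, LinearMap.mkContinuous_norm_le _ hC _⟩
  · intro ξ
    have h := lp.norm_mono (p := 2) two_ne_zero
      (x := (⟨fun x => a x * b.repr ξ x, memℓp_two_mul ha (b.repr ξ)⟩ : lp (fun _ : ι => ℂ) 2))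
      (y := (C : ℂ) • b.repr ξ) (fun x => by
        simp only [norm_mul, lp.coeFn_smul, Pi.smul_apply, smul_eq_mul, Complex.norm_real]
        exact mul_le_mul_of_nonneg_right ((ha x).trans (le_abs_self C)) (norm_nonneg _))
    rw [norm_smul, Complex.norm_real, Real.norm_of_nonneg hC, b.repr.norm_map] at h
    simpa using h
  · simp

theorem IsDiag.exists_of_norm_le {T : H →L[ℂ] H} {a c : ι → ℂ} (hT : IsDiag b T a)
    (hc : ∀ x, ‖c x‖ ≤ ‖a x‖) : ∃ S : H →L[ℂ] H, IsDiag b S c := by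
  obtain ⟨S, hS, -⟩ := exists_isDiag b (norm_nonneg T) fun x => (hc x).trans (hT.norm_le x)
  exact ⟨S, hS⟩

theorem IsDiag.add {T S : H →L[ℂ] H} {a c : ι → ℂ} (hT : IsDiag b T a)
    (hS : IsDiag b S c) : IsDiag b (T + S) (fun x => a x + c x) := by
  intro ξ x
  simp [hT ξ x, hS ξ x, add_mul]

theorem IsDiag.sub {T S : H →L[ℂ] H} {a c : ι → ℂ} (hT : IsDiag b T a)
    (hS : IsDiag b S c) : IsDiag b (T - S) (fun x => a x - c x) := by
  intro ξ x
  simp [hT ξ x, hS ξ x, sub_mul]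

theorem IsDiag.smul {T : H →L[ℂ] H} {a : ι → ℂ} (hT : IsDiag b T a) (c : ℂ) :
    IsDiag b (c • T) (fun x => c * a x) := by
  intro ξ x
  simp [hT ξ x, mul_assoc]

theorem IsDiag.mul {T S : H →L[ℂ] H} {a c : ι → ℂ} (hT : IsDiag b T a)
    (hS : IsDiag b S c) : IsDiag b (T * S) (fun x => a x * c x) := by
  intro ξ x
  rw [mul_apply_eq_comp, hT, hS, mul_assoc]

theorem isDiag_one : IsDiag b 1 (fun _ => 1) := by
  intro ξ x
  simp

theorem isDiag_zero : IsDiag b 0 (fun _ => 0) := by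
  intro ξ x
  simp

theorem exists_isDiag_lp (b : HilbertBasis ι ℂ H) (a : lp (fun _ : ι => ℂ) ∞) :
    ∃ T : H →L[ℂ] H, IsDiag b T (fun x => a x) ∧ ‖T‖ ≤ ‖a‖ :=
  exists_isDiag b (norm_nonneg a) (lp.norm_apply_le_norm ENNReal.top_ne_zero a)

/-- Expanding ⟨c_i, T c_i⟩ in the basis b gives the double family a_x |⟨b_x, c_i⟩|². By Parseval,
summing over i first leaves a_x; absolute summability of a permits the exchange. The trace is
therefore the same in every basis. -/
theorem IsDiag.hasSum_inner {T : H →L[ℂ] H} {a : ι → ℂ} (hT : IsDiag b T a)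
    (ha : Summable fun x => ‖a x‖) {κ : Type*} (c : HilbertBasis κ ℂ H) :
    HasSum (fun i => (inner ℂ (c i) (T (c i)) : ℂ)) (∑' x, a x) := by
  let F : ι × κ → ℂ := fun p => a p.1 * (inner ℂ (b p.1) (c p.2) * inner ℂ (c p.2) (b p.1))
  have hrow : ∀ x, HasSum (fun i => F (x, i)) (a x) := by
    intro x
    have h := (c.hasSum_inner_mul_inner (b x) (b x)).mul_left (a x)
    rwa [inner_self_eq_norm_sq_to_K, b.orthonormal.1 x, RCLike.ofReal_one, one_pow, mul_one] at h
  have hnorm : ∀ p, ‖F p‖ = ‖a p.1‖ * ‖(inner ℂ (b p.1) (c p.2) : ℂ)‖ ^ 2 := by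
    intro p
    simp only [F, norm_mul]
    rw [norm_inner_symm (c p.2), sq]
  have hrown : ∀ x, HasSum (fun i => ‖F (x, i)‖) ‖a x‖ := by
    intro x
    have h2 := (c.hasSum_inner_mul_inner (b x) (b x)).mapL RCLike.reCLM
    have h3 : ∀ i, RCLike.reCLM ((inner ℂ (b x) (c i) : ℂ) * inner ℂ (c i) (b x)) =
        ‖(inner ℂ (b x) (c i) : ℂ)‖ ^ 2 := by
      intro i
      rw [← inner_conj_symm (c i) (b x), RCLike.mul_conj]
      simp only [RCLike.reCLM_apply]
      exact_mod_cast rfl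
    simp only [h3] at h2
    rw [inner_self_eq_norm_sq_to_K, b.orthonormal.1 x] at h2
    simp only [hnorm]
    simpa using h2.mul_left ‖a x‖
  have hF : Summable F := by
    refine Summable.of_norm ?_
    rw [summable_prod_of_nonneg fun _ => norm_nonneg _]
    refine ⟨fun x => (hrown x).summable, ?_⟩
    simpa only [fun x => (hrown x).tsum_eq] using ha
  have hA := hF.hasSum
  have hA' : ∑' p, F p = ∑' x, a x := (hA.prod_fiberwise hrow).tsum_eq.symm
  rw [hA'] at hA
  -- The other order of summation: for fixed i, the sum over x is ⟨c_i, T c_i⟩.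
  refine HasSum.prod_fiberwise ((Equiv.prodComm κ ι).hasSum_iff.2 hA) fun i => ?_
  have h := lp.hasSum_inner (𝕜 := ℂ) (b.repr (c i)) (b.repr (T (c i)))
  rw [b.repr.inner_map_map] at h
  refine (congrArg (HasSum · _) (funext fun x => ?_)).mp h
  rw [hT]
  simp only [Function.comp_apply, Equiv.prodComm_apply, Prod.swap_prod_mk, F, RCLike.inner_apply,
    b.repr_apply_apply, inner_conj_symm]
  ring

variable [CompleteSpace H]

theorem IsDiag.star {T : H →L[ℂ] H} {a : ι → ℂ} (hT : IsDiag b T a) :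
    IsDiag b (star T) (fun x => star (a x)) := by
  obtain ⟨S, hS⟩ := hT.exists_of_norm_le (c := fun x => Star.star (a x)) (by simp)
  suffices Star.star T = S by rwa [this]
  rw [ContinuousLinearMap.star_eq_adjoint, eq_comm, ContinuousLinearMap.eq_adjoint_iff]
  intro ξ η
  rw [← b.repr.inner_map_map, ← b.repr.inner_map_map ξ, lp.inner_eq_tsum, lp.inner_eq_tsum]
  congr 1
  ext x
  rw [hT, hS]
  simp
  ring

/-- The operator S with entries √a_x satisfies T = S* S. -/
theorem IsDiag.nonneg {T : H →L[ℂ] H} {a : ι → ℝ} (hT : IsDiag b T (fun x => (a x : ℂ)))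
    (ha : ∀ x, 0 ≤ a x) : 0 ≤ T := by
  obtain ⟨S, hS, -⟩ := exists_isDiag b (a := fun x => (Real.sqrt (a x) : ℂ))
    (Real.sqrt_nonneg ‖T‖) (by
      intro x
      rw [Complex.norm_real, Real.norm_of_nonneg (Real.sqrt_nonneg _)]
      refine Real.sqrt_le_sqrt ?_
      have := hT.norm_le x
      rwa [Complex.norm_real, Real.norm_of_nonneg (ha x)] at this)
  have h : T = Star.star S * S := by
    refine hT.unique ?_
    convert hS.star.mul hS using 2 with x
    simp only [RCLike.star_def, Complex.conj_ofReal]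
    rw [← Complex.ofReal_mul, Real.mul_self_sqrt (ha x)]
  rw [h]
  exact star_mul_self_nonneg S

/-- Uniqueness of the positive square root of T*T. Only T*T has to be diagonal: this is used for
D⁻¹, which permutes the basis vectors up to factors. -/
theorem isDiag_abs_of_star_mul_self {T : H →L[ℂ] H} {a : ι → ℝ} (ha : ∀ x, 0 ≤ a x)
    {C : ℝ} (haC : ∀ x, a x ≤ C) (hC : 0 ≤ C)
    (hT : IsDiag b (star T * T) (fun x => (a x * a x : ℂ))) :
    IsDiag b (CFC.abs T) (fun x => (a x : ℂ)) := by
  obtain ⟨S, hS, -⟩ := exists_isDiag b (a := fun x => (a x : ℂ)) hC (by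
    intro x
    rw [Complex.norm_real, Real.norm_of_nonneg (ha x)]
    exact haC x)
  have h : CFC.abs T = S := CFC.sqrt_unique ((hS.mul hS).unique hT) (hS.nonneg ha)
  rwa [h]

theorem IsDiag.abs {T : H →L[ℂ] H} {a : ι → ℂ} (hT : IsDiag b T a) :
    IsDiag b (CFC.abs T) (fun x => (‖a x‖ : ℂ)) := by
  refine isDiag_abs_of_star_mul_self (fun x => norm_nonneg _) hT.norm_le (norm_nonneg _) ?_
  convert hT.star.mul hT using 2 with x
  rw [RCLike.star_def, Complex.conj_mul', sq]

theorem IsDiag.realPart {T : H →L[ℂ] H} {a : ι → ℂ} (hT : IsDiag b T a) :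
    IsDiag b (ℜ T : H →L[ℂ] H) (fun x => ((a x).re : ℂ)) := by
  rw [realPart_apply_coe, ← Complex.coe_smul]
  convert (hT.add hT.star).smul ((2⁻¹ : ℝ) : ℂ) using 2 with x
  rw [Complex.re_eq_add_conj]
  simp
  ring

theorem IsDiag.imaginaryPart {T : H →L[ℂ] H} {a : ι → ℂ} (hT : IsDiag b T a) :
    IsDiag b (ℑ T : H →L[ℂ] H) (fun x => ((a x).im : ℂ)) := by
  rw [imaginaryPart_apply_coe, ← Complex.coe_smul]
  convert ((hT.sub hT.star).smul ((2⁻¹ : ℝ) : ℂ)).smul (-Complex.I) using 2 with x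
  rw [Complex.im_eq_sub_conj]
  simp
  field_simp
  rw [Complex.I_sq]
  ring

/-- The decomposition T = P - Q with P, Q ≥ 0 and PQ = 0 is unique, and the entrywise positive and
negative parts provide one. -/
theorem IsDiag.posPart_and_negPart {T : H →L[ℂ] H} {a : ι → ℝ}
    (hT : IsDiag b T (fun x => (a x : ℂ))) :
    IsDiag b T⁺ (fun x => ((max (a x) 0 : ℝ) : ℂ)) ∧
      IsDiag b T⁻ (fun x => ((max (-a x) 0 : ℝ) : ℂ)) := by
  obtain ⟨P, hP⟩ := hT.exists_of_norm_le (c := fun x => ((max (a x) 0 : ℝ) : ℂ)) (by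
    intro x
    rw [Complex.norm_real, Complex.norm_real, Real.norm_of_nonneg (le_max_right _ _)]
    exact max_le (le_abs_self _) (abs_nonneg _))
  obtain ⟨Q, hQ⟩ := hT.exists_of_norm_le (c := fun x => ((max (-a x) 0 : ℝ) : ℂ)) (by
    intro x
    rw [Complex.norm_real, Complex.norm_real, Real.norm_of_nonneg (le_max_right _ _)]
    exact max_le (neg_le_abs _) (abs_nonneg _))
  have hPQ := CFC.posPart_negPart_unique (a := T) (b := P) (c := Q) (hT.unique (by
    convert hP.sub hQ using 2 with x
    rw [← Complex.ofReal_sub]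
    congr 1
    rcases le_total 0 (a x) with h | h
    · rw [max_eq_left h, max_eq_right (by linarith), sub_zero]
    · rw [max_eq_right h, max_eq_left (by linarith)]; ring))
    ((hP.mul hQ).unique (by
      convert isDiag_zero using 2 with x
      rw [← Complex.ofReal_mul]
      rcases le_total 0 (a x) with h | h
      · rw [max_eq_right (by linarith : -a x ≤ 0), mul_zero, Complex.ofReal_zero]
      · rw [max_eq_right h, zero_mul, Complex.ofReal_zero]))
    (hP.nonneg fun x => le_max_right _ _) (hQ.nonneg fun x => le_max_right _ _)
  rw [hPQ.1, hPQ.2]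
  exact ⟨hP, hQ⟩

/-- Multiplication by bounded functions, as a representation of `ℓ^∞`. -/
noncomputable def diagHom (b : HilbertBasis ι ℂ H) :
    lp (fun _ : ι => ℂ) ∞ →⋆ₐ[ℂ] (H →L[ℂ] H) where
  toFun a := (exists_isDiag_lp b a).choose
  map_one' := (exists_isDiag_lp b 1).choose_spec.1.unique isDiag_one
  map_mul' a c := (exists_isDiag_lp b (a * c)).choose_spec.1.unique
    ((exists_isDiag_lp b a).choose_spec.1.mul (exists_isDiag_lp b c).choose_spec.1)
  map_zero' := (exists_isDiag_lp b 0).choose_spec.1.unique isDiag_zero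
  map_add' a c := (exists_isDiag_lp b (a + c)).choose_spec.1.unique
    ((exists_isDiag_lp b a).choose_spec.1.add (exists_isDiag_lp b c).choose_spec.1)
  commutes' c := by
    refine (exists_isDiag_lp b _).choose_spec.1.unique ?_
    rw [Algebra.algebraMap_eq_smul_one]
    convert isDiag_one.smul c using 2
    exact (mul_one c).symm
  map_star' a := (exists_isDiag_lp b (star a)).choose_spec.1.unique
    (exists_isDiag_lp b a).choose_spec.1.star

theorem isDiag_diagHom (b : HilbertBasis ι ℂ H) (a : lp (fun _ : ι => ℂ) ∞) :
    IsDiag b (diagHom b a) (fun x => a x) :=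
  (exists_isDiag_lp b a).choose_spec.1

theorem norm_diagHom_le (b : HilbertBasis ι ℂ H) (a : lp (fun _ : ι => ℂ) ∞) :
    ‖diagHom b a‖ ≤ ‖a‖ :=
  (exists_isDiag_lp b a).choose_spec.2

/-- Evaluation at a coordinate, as a character of `ℓ^∞`. -/
noncomputable def evalHom (x : ι) : lp (fun _ : ι => ℂ) ∞ →⋆ₐ[ℂ] ℂ where
  toFun a := a x
  map_one' := rfl
  map_mul' _ _ := rfl
  map_zero' := rfl
  map_add' _ _ := rfl
  commutes' _ := rfl
  map_star' _ := rfl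

/-- Both the diagonal representation of ℓ^∞ and the evaluation at a coordinate are continuous star
homomorphisms, hence commute with the functional calculus. Applied to the element a of ℓ^∞, the
second computes the entries of `cfc f A` and the first transports them to T. -/
theorem IsDiag.cfc {T : H →L[ℂ] H} {a : ι → ℂ} (hT : IsDiag b T a) {f : ℂ → ℂ}
    {s : Set ℂ} (hf : ContinuousOn f s) (hs : IsClosed s) (ha : ∀ x, a x ∈ s) :
    IsDiag b (cfc f T) (fun x => f (a x)) := by
  let A : lp (fun _ : ι => ℂ) ∞ := ⟨a, memℓp_infty ⟨‖T‖, by rintro _ ⟨x, rfl⟩; exact hT.norm_le x⟩⟩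
  have hTA : T = diagHom b A := hT.unique (isDiag_diagHom b A)
  -- A point z off the closed set s has positive distance ε to all entries, so the entries (z -
  -- a_x)⁻¹ are bounded by ε⁻¹ and invert z - A.
  have hspec : spectrum ℂ A ⊆ s := by
    intro z hz
    by_contra hzs
    obtain ⟨ε, hε, hball⟩ := Metric.isOpen_iff.1 hs.isOpen_compl z hzs
    have hd : ∀ x, ε ≤ ‖z - a x‖ := by
      intro x
      by_contra h
      exact hball (by rw [Metric.mem_ball, dist_comm, dist_eq_norm]; exact not_le.1 h) (ha x)
    have hd0 : ∀ x, z - a x ≠ 0 := fun x h => by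
      have := hd x
      rw [h, norm_zero] at this
      linarith
    let B : lp (fun _ : ι => ℂ) ∞ := ⟨fun x => (z - a x)⁻¹, memℓp_infty ⟨ε⁻¹, by
      rintro _ ⟨x, rfl⟩
      simp only [norm_inv]
      exact inv_anti₀ hε (hd x)⟩⟩
    refine hz ?_
    refine IsUnit.of_mul_eq_one B ?_
    ext x
    exact mul_inv_cancel₀ (hd0 x)
  have hc : Continuous (diagHom b) := by
    refine AddMonoidHomClass.continuous_of_bound (diagHom b) 1 fun a => ?_
    rw [one_mul]
    exact norm_diagHom_le b a
  have hfA : ContinuousOn f (spectrum ℂ A) := hf.mono hspec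
  have h1 : diagHom b (_root_.cfc f A) = _root_.cfc f (diagHom b A) :=
    StarAlgHom.map_cfc (diagHom b) f A hfA hc
  intro ξ x
  have h2 : evalHom x (_root_.cfc f A) = _root_.cfc f (evalHom x A) :=
    StarAlgHom.map_cfc (evalHom x) f A hfA
      ((lp.lipschitzWith_one_eval (E := fun _ : ι => ℂ) ∞ x).continuous)
  have h3 : _root_.cfc f (evalHom x A) = f (a x) := by
    have := cfc_algebraMap (A := ℂ) (a x) f
    exact this
  have h4 : (_root_.cfc f A : lp (fun _ : ι => ℂ) ∞) x = f (a x) := h2.trans h3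
  rw [hTA, ← h1, isDiag_diagHom]
  exact congrArg (· * b.repr ξ x) h4

/-- Only finitely many entries have modulus at least 1/(n+1). Keeping just these gives operators of
finite rank that converge to T in norm. -/
theorem IsDiag.isCompactOperator {T : H →L[ℂ] H} {a : ι → ℂ} (hT : IsDiag b T a)
    (ha : Filter.Tendsto a Filter.cofinite (nhds 0)) : IsCompactOperator T := by
  classical
  have hfin : ∀ n : ℕ, {x | ¬ ‖a x‖ < 1 / ((n : ℝ) + 1)}.Finite := fun n => by
    have h := (Metric.tendsto_nhds.1 ha) (1 / ((n : ℝ) + 1)) Nat.one_div_pos_of_nat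
    simp only [dist_zero_right] at h
    exact Filter.eventually_cofinite.1 h
  have hS : ∀ n : ℕ, ∃ S : H →L[ℂ] H, IsCompactOperator S ∧ ‖T - S‖ ≤ 1 / ((n : ℝ) + 1) := by
    intro n
    -- R carries the small entries, so T - R has finite rank and differs from T by an operator of
    -- norm at most 1/(n+1).
    obtain ⟨R, hR, hRn⟩ := exists_isDiag b (C := 1 / ((n : ℝ) + 1))
      (a := fun x => if ‖a x‖ < 1 / ((n : ℝ) + 1) then a x else 0) (by positivity) (by
        intro x
        split_ifs with h
        · exact h.le
        · rw [norm_zero]; positivity)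
    refine ⟨T - R, ?_, by rwa [sub_sub_cancel]⟩
    have hrange : ∀ ξ, (T - R) ξ ∈ Submodule.span ℂ (b '' {x | ¬ ‖a x‖ < 1 / ((n : ℝ) + 1)}) := by
      intro ξ
      refine b.mem_span_image (hfin n) fun x hx => ?_
      rw [Set.mem_ofPred_eq, not_not] at hx
      refine (hT.sub hR ξ x).trans ?_
      simp only [if_pos hx, sub_self, zero_mul]
    have : FiniteDimensional ℂ
        (Submodule.span ℂ (b '' {x | ¬ ‖a x‖ < 1 / ((n : ℝ) + 1)})) :=
      FiniteDimensional.span_of_finite ℂ ((hfin n).image _)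
    have := FiniteDimensional.proper ℂ
      (Submodule.span ℂ (b '' {x | ¬ ‖a x‖ < 1 / ((n : ℝ) + 1)}))
    have hcod := isCompactOperator_id (E := Submodule.span ℂ
      (b '' {x | ¬ ‖a x‖ < 1 / ((n : ℝ) + 1)}))
    exact (hcod.comp_clm ((T - R).codRestrict _ hrange)).clm_comp (Submodule.subtypeL _)
  choose S hSc hSn using hS
  refine isCompactOperator_of_tendsto (l := Filter.atTop) (F := S) ?_
    (Filter.Eventually.of_forall hSc)
  rw [tendsto_iff_norm_sub_tendsto_zero]
  refine squeeze_zero (fun _ => norm_nonneg _) (fun n => ?_) tendsto_one_div_add_atTop_nhds_zero_nat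
  rw [norm_sub_rev]
  exact hSn n

theorem IsDiag.isTraceClass_iff {T : H →L[ℂ] H} {a : ι → ℂ} (hT : IsDiag b T a) :
    IsTraceClass T ↔ Summable fun x => ‖a x‖ := by
  constructor
  · intro h
    have h1 := h ι b
    simp only [hT.abs.apply_basis, inner_smul_right, inner_self_eq_norm_sq_to_K,
      b.orthonormal.1] at h1
    simp at h1
    exact_mod_cast h1
  · intro h κ c
    exact (hT.abs.hasSum_inner (by simpa using h) c).summable

theorem IsDiag.opTrace_eq {T : H →L[ℂ] H} {a : ι → ℂ} (hT : IsDiag b T a)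
    (ha : Summable fun x => ‖a x‖) : opTrace T = ∑' x, a x :=
  (hT.hasSum_inner ha _).tsum_eq

end DiagonalOperators

/-! ### Singular values of diagonal operators -/

section SingularValues

universe u

variable {ι H : Type u} [NormedAddCommGroup H] [InnerProductSpace ℂ H]
  {b : HilbertBasis ι ℂ H}

/-- An eigenvector for r is supported on the coordinates with a_x = r, so the eigenspaces above t
span the same finite-dimensional space as the b_x with a_x > t. This turns singular values into a
count of entries. -/
theorem IsDiag.rank_iSup_eigenspace_le_iff {T : H →L[ℂ] H} {a : ι → ℝ}
    (hT : IsDiag b T (fun x => (a x : ℂ))) (t : ℝ) (j : ℕ) :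
    Module.rank ℂ (⨆ (r : ℝ) (_ : t < r), Module.End.eigenspace T.toLinearMap (r : ℂ) :
        Submodule ℂ H) ≤ j ↔ Cardinal.mk {x | t < a x} ≤ j := by
  constructor
  · intro h
    refine le_trans ?_ h
    let v : {x | t < a x} → (⨆ (r : ℝ) (_ : t < r),
        Module.End.eigenspace T.toLinearMap (r : ℂ) : Submodule ℂ H) := fun x =>
      ⟨b x.1, Submodule.mem_iSup_of_mem (a x.1) (Submodule.mem_iSup_of_mem x.2
        (Module.End.mem_eigenspace_iff.2 (hT.apply_basis x.1)))⟩
    refine LinearIndependent.cardinal_le_rank (v := v) ?_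
    refine LinearIndependent.of_comp (Submodule.subtype _) ?_
    exact b.orthonormal.linearIndependent.comp _ Subtype.val_injective
  · intro h
    have hfin : {x | t < a x}.Finite := by
      rw [← Cardinal.lt_aleph0_iff_set_finite]
      exact h.trans_lt (Cardinal.natCast_lt_aleph0)
    have hle : (⨆ (r : ℝ) (_ : t < r), Module.End.eigenspace T.toLinearMap (r : ℂ) :
        Submodule ℂ H) ≤ Submodule.span ℂ (b '' {x | t < a x}) := by
      refine iSup₂_le fun r hr ξ hξ => b.mem_span_image hfin fun x hx => ?_
      rw [Module.End.mem_eigenspace_iff] at hξ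
      have h1 := hT ξ x
      have h2 : b.repr (T ξ) x = r * b.repr ξ x := by
        have : T ξ = (r : ℂ) • ξ := hξ
        rw [this, map_smul]
        rfl
      rw [h2] at h1
      by_contra h0
      have h3 : (r : ℂ) = (a x : ℂ) := mul_right_cancel₀ h0 h1
      have h4 : r = a x := by exact_mod_cast h3
      exact hx (by rw [Set.mem_ofPred_eq, ← h4]; exact hr)
    exact (Submodule.rank_mono hle).trans ((rank_span_le _).trans (Cardinal.mk_image_le.trans h))

variable [CompleteSpace H]

theorem IsDiag.abs_of_nonneg {T : H →L[ℂ] H} {a : ι → ℝ}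
    (hT : IsDiag b T (fun x => (a x : ℂ))) (ha : ∀ x, 0 ≤ a x) :
    IsDiag b (CFC.abs T) (fun x => (a x : ℂ)) := by
  convert hT.abs using 2 with x
  rw [Complex.norm_real, Real.norm_of_nonneg (ha x)]

theorem IsDiag.singVal_eq {T : H →L[ℂ] H} {a : ι → ℝ}
    (hT : IsDiag b T (fun x => (a x : ℂ))) (ha : ∀ x, 0 ≤ a x) (j : ℕ) :
    singVal T j = sInf {t : ℝ | 0 ≤ t ∧ Cardinal.mk {x | t < a x} ≤ j} := by
  unfold singVal
  congr 1
  ext t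
  exact and_congr_right fun _ => (hT.abs_of_nonneg ha).rank_iSup_eigenspace_le_iff t j

theorem singVal_nonneg (T : H →L[ℂ] H) (j : ℕ) : 0 ≤ singVal T j :=
  Real.sInf_nonneg fun _ ht => ht.1

theorem IsDiag.singVal_le {T : H →L[ℂ] H} {a : ι → ℝ}
    (hT : IsDiag b T (fun x => (a x : ℂ))) (ha : ∀ x, 0 ≤ a x) {t : ℝ} (ht : 0 ≤ t)
    {B : Finset ι} {j : ℕ} (hB : B.card ≤ j) (h : ∀ x, t < a x → x ∈ B) : singVal T j ≤ t := by
  rw [hT.singVal_eq ha]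
  refine csInf_le ⟨0, fun _ hs => hs.1⟩ ⟨ht, ?_⟩
  have h1 : Cardinal.mk {x | t < a x} ≤ Cardinal.mk (B : Set ι) := Cardinal.mk_le_mk_of_subset h
  refine h1.trans ?_
  rw [Finset.coe_sort_coe, Cardinal.mk_coe_finset]
  exact_mod_cast hB

theorem IsDiag.le_singVal {T : H →L[ℂ] H} {a : ι → ℝ}
    (hT : IsDiag b T (fun x => (a x : ℂ))) (ha : ∀ x, 0 ≤ a x) {c : ℝ}
    {A : Finset ι} {j : ℕ} (hA : j < A.card) (h : ∀ x ∈ A, c ≤ a x) : c ≤ singVal T j := by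
  rw [hT.singVal_eq ha]
  -- No entry exceeds ‖T‖, so the infimum is over a nonempty set.
  refine le_csInf ⟨‖T‖, norm_nonneg T, ?_⟩ ?_
  · have : {x | ‖T‖ < a x} = ∅ := by
      refine Set.eq_empty_of_forall_notMem fun x hx => ?_
      have h1 := hT.norm_le x
      rw [Complex.norm_real, Real.norm_of_nonneg (ha x)] at h1
      exact absurd (lt_of_lt_of_le hx h1) (lt_irrefl _)
    rw [this, Cardinal.mk_eq_zero]
    exact zero_le
  · rintro t ⟨-, ht⟩
    by_contra hlt
    rw [not_le] at hlt
    have h1 : Cardinal.mk (A : Set ι) ≤ Cardinal.mk {x | t < a x} :=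
      Cardinal.mk_le_mk_of_subset fun x hx => lt_of_lt_of_le hlt (h x hx)
    rw [Finset.coe_sort_coe, Cardinal.mk_coe_finset] at h1
    have h2 : A.card ≤ j := by exact_mod_cast h1.trans ht
    omega

/-- Induction on the size of A, removing a smallest entry: among n + 1 entries the smallest is at
most `singVal T n`, as indexing starts at 0. -/
theorem IsDiag.sum_le_singSum {T : H →L[ℂ] H} {a : ι → ℝ}
    (hT : IsDiag b T (fun x => (a x : ℂ))) (ha : ∀ x, 0 ≤ a x) (A : Finset ι) :
    ∑ x ∈ A, a x ≤ singSum T A.card := by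
  classical
  induction hn : A.card generalizing A with
  | zero => rw [Finset.card_eq_zero.1 hn]; simp [singSum]
  | succ n ih =>
    obtain ⟨x, hx, hmin⟩ := A.exists_min_image a (Finset.card_pos.1 (by omega))
    have h1 := ih (A.erase x) (by rw [Finset.card_erase_of_mem hx]; omega)
    have h2 := hT.le_singVal ha (j := n) (by omega) hmin
    rw [singSum, Finset.sum_range_succ, ← Finset.sum_erase_add _ _ hx]
    exact add_le_add h1 h2

theorem singSum_mono (T : H →L[ℂ] H) : Monotone (singSum T) := fun _ _ h =>
  Finset.sum_le_sum_of_subset_of_nonneg (Finset.range_mono h) fun j _ _ => singVal_nonneg T j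

/-- C is an upper segment of B. With x its smallest entry, every entry outside C is at most max(a_x,
β) ≤ a_x + β, so only the other n elements of C can exceed a_x + β. Paying β per index avoids
sorting B against the entries outside it, and in the application the total loss stays bounded. -/
theorem IsDiag.singSum_card_le {T : H →L[ℂ] H} {a : ι → ℝ}
    (hT : IsDiag b T (fun x => (a x : ℂ))) (ha : ∀ x, 0 ≤ a x) {β : ℝ} (hβ : 0 ≤ β)
    {B : Finset ι} (hB : ∀ x ∉ B, a x ≤ β) (C : Finset ι) (hCB : C ⊆ B)
    (hC : ∀ x ∈ C, ∀ y ∈ B, y ∉ C → a y ≤ a x) :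
    singSum T C.card ≤ ∑ x ∈ C, a x + C.card * β := by
  classical
  induction hn : C.card generalizing C with
  | zero => rw [Finset.card_eq_zero.1 hn]; simp [singSum]
  | succ n ih =>
    obtain ⟨x, hx, hmin⟩ := C.exists_min_image a (Finset.card_pos.1 (by omega))
    have hcard : (C.erase x).card = n := by rw [Finset.card_erase_of_mem hx]; omega
    have h1 := ih (C.erase x) ((Finset.erase_subset x C).trans hCB) (by
      intro z hz y hy hyC
      rw [Finset.mem_erase] at hz
      by_cases hyx : y = x
      · rw [hyx]; exact hmin z hz.2
      · exact hC z hz.2 y hy fun h => hyC (Finset.mem_erase.2 ⟨hyx, h⟩)) hcard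
    have h2 : singVal T n ≤ a x + β := by
      refine hT.singVal_le ha (add_nonneg (ha x) hβ) (B := C.erase x) hcard.le fun y hy => ?_
      have hyB : y ∈ B := by
        by_contra h
        linarith [hB y h, ha x]
      have hyC : y ∈ C := by
        by_contra h
        linarith [hC x hx y hyB h]
      refine Finset.mem_erase.2 ⟨?_, hyC⟩
      rintro rfl
      linarith
    rw [singSum, Finset.sum_range_succ, ← Finset.sum_erase_add _ _ hx]
    rw [singSum] at h1
    push_cast
    linarith

theorem IsDiag.singSum_le {T : H →L[ℂ] H} {a : ι → ℝ}
    (hT : IsDiag b T (fun x => (a x : ℂ))) (ha : ∀ x, 0 ≤ a x) {β : ℝ} (hβ : 0 ≤ β)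
    {B : Finset ι} (hB : ∀ x ∉ B, a x ≤ β) {n : ℕ} (hn : B.card ≤ n) :
    singSum T n ≤ ∑ x ∈ B, a x + n * β := by
  have h1 := hT.singSum_card_le ha hβ hB B subset_rfl fun _ _ y hy hyB => absurd hy hyB
  have h2 : ∑ j ∈ Finset.Ico B.card n, singVal T j ≤ ∑ _j ∈ Finset.Ico B.card n, β := by
    refine Finset.sum_le_sum fun j hj => hT.singVal_le ha hβ (Finset.mem_Ico.1 hj).1 fun x hx => ?_
    by_contra h
    linarith [hB x h]
  rw [Finset.sum_const, Nat.card_Ico, nsmul_eq_mul, Nat.cast_sub hn] at h2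
  rw [singSum, ← Finset.sum_range_add_sum_Ico _ hn]
  rw [singSum] at h1
  linarith

/-- For E k^ν ≤ M < E k^(ν+1), S_M lies between the sum over B_ν and that sum plus M C / k^ν ≤ E k
C. Dividing S_M and log M by ν removes the bounded errors, and the quotient of the two limits is L /
log k. -/
theorem IsDiag.tendsto_logMean {T : H →L[ℂ] H} {a : ι → ℝ}
    (hT : IsDiag b T (fun x => (a x : ℂ))) (ha : ∀ x, 0 ≤ a x) {k E : ℕ} (hk : 1 < k) (hE : 0 < E)
    {C L : ℝ} (hC : 0 ≤ C) {B : ℕ → Finset ι} (hcard : ∀ n, (B n).card ≤ E * k ^ n)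
    (hB : ∀ n, ∀ x ∉ B n, a x ≤ C / k ^ n)
    (hL : Filter.Tendsto (fun n : ℕ => (∑ x ∈ B n, a x) / n) Filter.atTop (nhds L)) :
    Filter.Tendsto (logMean T) Filter.atTop (nhds (L / Real.log k)) := by
  have hk0 : (0 : ℝ) < k := by exact_mod_cast (zero_lt_one.trans hk)
  have hE0 : (0 : ℝ) < E := by exact_mod_cast hE
  have hlogk : 0 < Real.log k := Real.log_pos (by exact_mod_cast hk)
  -- The largest ν with E k^ν ≤ M, once M ≥ E; for smaller M the value is irrelevant.
  let ν : ℕ → ℕ := fun M => Nat.log k (M / E)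
  have hν : Filter.Tendsto ν Filter.atTop Filter.atTop := by
    refine Filter.tendsto_atTop.2 fun n => ?_
    filter_upwards [Filter.eventually_ge_atTop (k ^ n * E)] with M hM
    exact Nat.le_log_of_pow_le hk ((Nat.le_div_iff_mul_le hE).2 hM)
  have hlow : ∀ M, E ≤ M → E * k ^ ν M ≤ M := by
    intro M hM
    have h := Nat.pow_log_le_self k (x := M / E) (Nat.div_pos hM hE).ne'
    rw [mul_comm]
    exact (Nat.le_div_iff_mul_le hE).1 h
  have hup : ∀ M, M < E * k ^ (ν M + 1) := by
    intro M
    have h := Nat.lt_pow_succ_log_self hk (M / E)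
    rw [mul_comm]
    exact (Nat.div_lt_iff_lt_mul hE).1 h
  have hν0 : ∀ᶠ M in Filter.atTop, (0 : ℝ) < ν M := by
    filter_upwards [hν.eventually_gt_atTop 0] with M hM
    exact_mod_cast hM
  have hνR : Filter.Tendsto (fun M => (ν M : ℝ)) Filter.atTop Filter.atTop :=
    tendsto_natCast_atTop_atTop.comp hν
  have hlog : Filter.Tendsto (fun M : ℕ => Real.log M / ν M) Filter.atTop
      (nhds (Real.log k)) := by
    have h1 : Filter.Tendsto (fun M : ℕ => Real.log k + Real.log E / ν M) Filter.atTop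
        (nhds (Real.log k)) := by
      simpa using tendsto_const_nhds.add (hνR.const_div_atTop (Real.log E))
    have h2 : Filter.Tendsto (fun M : ℕ => Real.log k + (Real.log k + Real.log E) / ν M)
        Filter.atTop (nhds (Real.log k)) := by
      simpa using tendsto_const_nhds.add (hνR.const_div_atTop (Real.log k + Real.log E))
    refine tendsto_of_tendsto_of_tendsto_of_le_of_le' h1 h2 ?_ ?_
    · filter_upwards [hν0, Filter.eventually_ge_atTop E] with M hM hME
      rw [le_div_iff₀ hM, add_mul, div_mul_cancel₀ _ hM.ne']
      have h3 : ((E : ℝ) * k ^ ν M) ≤ M := by exact_mod_cast hlow M hME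
      have h4 := Real.log_le_log (by positivity) h3
      rw [Real.log_mul hE0.ne' (by positivity), Real.log_pow] at h4
      linarith
    · filter_upwards [hν0, Filter.eventually_ge_atTop E] with M hM hME
      rw [div_le_iff₀ hM, add_mul, div_mul_cancel₀ _ hM.ne']
      have h3 : (M : ℝ) ≤ (E : ℝ) * k ^ (ν M + 1) := by exact_mod_cast (hup M).le
      have hM0 : (0 : ℝ) < M := by exact_mod_cast hE.trans_le hME
      have h4 := Real.log_le_log hM0 h3
      rw [Real.log_mul hE0.ne' (by positivity), Real.log_pow] at h4
      push_cast at h4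
      linarith
  have hsum : Filter.Tendsto (fun M : ℕ => singSum T M / ν M) Filter.atTop (nhds L) := by
    have h1 : Filter.Tendsto (fun M : ℕ => (∑ x ∈ B (ν M), a x) / ν M) Filter.atTop (nhds L) :=
      hL.comp hν
    have h2 : Filter.Tendsto (fun M : ℕ => (∑ x ∈ B (ν M), a x) / ν M + E * k * C / ν M)
        Filter.atTop (nhds L) := by
      simpa using h1.add (hνR.const_div_atTop (E * k * C))
    refine tendsto_of_tendsto_of_tendsto_of_le_of_le' h1 h2 ?_ ?_
    · filter_upwards [hν0, Filter.eventually_ge_atTop E] with M hM hME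
      refine div_le_div_of_nonneg_right ?_ hM.le
      exact (hT.sum_le_singSum ha _).trans (singSum_mono T ((hcard _).trans (hlow M hME)))
    · filter_upwards [hν0, Filter.eventually_ge_atTop E] with M hM hME
      rw [← add_div]
      refine div_le_div_of_nonneg_right ?_ hM.le
      refine (hT.singSum_le ha (by positivity) (hB (ν M))
        ((hcard _).trans (hlow M hME))).trans ?_
      refine add_le_add_right ?_ _
      have h3 : (M : ℝ) ≤ (E : ℝ) * k ^ (ν M + 1) := by exact_mod_cast (hup M).le
      have h4 : (0 : ℝ) < (k : ℝ) ^ ν M := by positivity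
      calc (M : ℝ) * (C / k ^ ν M) ≤ (E * k ^ (ν M + 1)) * (C / k ^ ν M) :=
            mul_le_mul_of_nonneg_right h3 (by positivity)
        _ = E * k * C := by rw [pow_succ]; field_simp
  refine (hsum.div hlog hlogk.ne').congr' ?_
  filter_upwards [hν0] with M hM
  simp only [logMean, Pi.div_apply]
  rw [div_div_div_cancel_right₀ hM.ne']

theorem exists_norm_logMean_le_of_tendsto {T : H →L[ℂ] H} {L : ℝ}
    (h : Filter.Tendsto (logMean T) Filter.atTop (nhds L)) : ∃ C : ℝ, ∀ n, ‖logMean T n‖ ≤ C := by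
  obtain ⟨C, hC⟩ := (Metric.isBounded_range_of_tendsto _ h).exists_norm_le
  exact ⟨C, fun n => hC _ ⟨n, rfl⟩⟩

theorem dixmierPos_eq_of_tendsto (ω : GeneralizedLimit) {T : H →L[ℂ] H} {L : ℝ}
    (h : Filter.Tendsto (logMean T) Filter.atTop (nhds L)) : dixmierPos ω T = L := by
  rw [dixmierPos, dif_pos (exists_norm_logMean_le_of_tendsto h)]
  exact ω.eq_limit _ _ h

end SingularValues

/-! ### Powers of an unbounded operator with diagonal square -/

section AbsNegPow

universe u

variable {ι H : Type u} [NormedAddCommGroup H] [InnerProductSpace ℂ H]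
  {b : HilbertBasis ι ℂ H}

theorem IsBoundedInverse.boundedInverse_eq {D : H →ₗ.[ℂ] H} {B : H →L[ℂ] H}
    (hB : IsBoundedInverse D B) : boundedInverse D = B := by
  have h : ∃ B, IsBoundedInverse D B := ⟨B, hB⟩
  rw [boundedInverse, dif_pos h]
  ext y
  exact (h.choose_spec (B y, y)).1 ((hB (B y, y)).2 rfl)

variable [CompleteSpace H]

/-- A weighted permutation along an involution that preserves real weights is self-adjoint, and
applying it twice multiplies by ℓ². -/
theorem isDiag_star_mul_self_of_involutive {B : H →L[ℂ] H} {ℓ : ι → ℝ} {r : ι → ι}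
    (hr : Function.Involutive r) (hℓ : ∀ x, ℓ (r x) = ℓ x)
    (hB : ∀ ξ x, b.repr (B ξ) x = ℓ x * b.repr ξ (r x)) :
    IsDiag b (star B * B) (fun x => (ℓ x * ℓ x : ℂ)) := by
  have hstar : star B = B := by
    rw [ContinuousLinearMap.star_eq_adjoint, eq_comm, ContinuousLinearMap.eq_adjoint_iff]
    intro ξ η
    rw [← b.repr.inner_map_map, ← b.repr.inner_map_map ξ, lp.inner_eq_tsum, lp.inner_eq_tsum,
      ← (hr.toPerm r).tsum_eq]
    congr 1
    ext x
    simp only [Function.Involutive.coe_toPerm, hB, hr x, hℓ, RCLike.inner_apply, map_mul,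
      Complex.conj_ofReal]
    ring
  rw [hstar]
  intro ξ x
  rw [mul_apply_eq_comp, hB, hB, hr x, hℓ, mul_assoc]

theorem isDiag_absNegPow {D : H →ₗ.[ℂ] H} {B : H →L[ℂ] H} (hD : IsBoundedInverse D B)
    {ℓ : ι → ℝ} {r : ι → ι} (hr : Function.Involutive r) (hℓ : ∀ x, ℓ (r x) = ℓ x)
    (hB : ∀ ξ x, b.repr (B ξ) x = ℓ x * b.repr ξ (r x)) (hpos : ∀ x, 0 ≤ ℓ x) {C : ℝ}
    (hC : 0 ≤ C) (hℓC : ∀ x, ℓ x ≤ C) {s : ℂ} (hs : 0 < s.re) :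
    IsDiag b (absNegPow D s) (fun x => (ℓ x : ℂ) ^ s) := by
  rw [absNegPow, hD.boundedInverse_eq]
  have habs := isDiag_abs_of_star_mul_self hpos hℓC hC (isDiag_star_mul_self_of_involutive hr hℓ hB)
  refine habs.cfc (s := {z : ℂ | 0 ≤ z.re}) ?_ (isClosed_le continuous_const Complex.continuous_re)
    fun x => ?_
  · intro z hz
    exact (Complex.continuousAt_cpow_const_of_re_pos (Or.inl hz) hs).continuousWithinAt
  · simpa using hpos x

end AbsNegPow

/-! ### Cells of a nested fractal -/

namespace SelfSimilarFractal

open MeasureTheory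

variable {N k : ℕ} (F : SelfSimilarFractal N k)

theorem dist_wWord (σ : List (Fin k)) (x y : EuclideanSpace ℝ (Fin N)) :
    dist (F.wWord σ x) (F.wWord σ y) = F.ratioWord σ * dist x y := by
  induction σ with
  | nil => simp [wWord, ratioWord]
  | cons i σ ih =>
    simp only [wWord, Function.comp_apply, F.dist_w, ih, ratioWord, List.map_cons, List.prod_cons]
    ring

theorem wWord_append (σ τ : List (Fin k)) : F.wWord (σ ++ τ) = F.wWord σ ∘ F.wWord τ := by
  induction σ with
  | nil => rfl
  | cons i σ ih => simp only [List.cons_append, wWord, ih, Function.comp_assoc]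

theorem ratioWord_pos (σ : List (Fin k)) : 0 < F.ratioWord σ :=
  List.prod_pos fun _ h => by
    obtain ⟨i, -, rfl⟩ := List.mem_map.1 h
    exact F.ratio_pos i

theorem wWord_injective (σ : List (Fin k)) : Function.Injective (F.wWord σ) := by
  intro x y h
  have h1 := F.dist_wWord σ x y
  rw [h, dist_self] at h1
  exact dist_eq_zero.1 ((mul_eq_zero.1 h1.symm).resolve_left (F.ratioWord_pos σ).ne')

theorem lipschitzWith_wWord (σ : List (Fin k)) :
    LipschitzWith (F.ratioWord σ).toNNReal (F.wWord σ) :=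
  LipschitzWith.of_dist_le_mul fun x y => by
    rw [F.dist_wWord, Real.coe_toNNReal _ (F.ratioWord_pos σ).le]

theorem antilipschitzWith_wWord (σ : List (Fin k)) :
    AntilipschitzWith (F.ratioWord σ)⁻¹.toNNReal (F.wWord σ) :=
  AntilipschitzWith.of_le_mul_dist fun x y => by
    rw [F.dist_wWord, Real.coe_toNNReal _ (inv_nonneg.2 (F.ratioWord_pos σ).le),
      inv_mul_cancel_left₀ (F.ratioWord_pos σ).ne']

/-- Similarities of a Euclidean space are onto. -/
theorem w_surjective (i : Fin k) : Function.Surjective (F.w i) := by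
  -- After rescaling, w_i is an isometry of a strictly convex space, hence affine; its linear part
  -- is injective, so onto in finite dimension.
  have hi : Isometry fun x => (F.ratio i)⁻¹ • F.w i x := by
    refine Isometry.of_dist_eq fun x y => ?_
    rw [dist_smul₀, F.dist_w, Real.norm_of_nonneg (inv_nonneg.2 (F.ratio_pos i).le),
      inv_mul_cancel_left₀ (F.ratio_pos i).ne']
  let φ := hi.affineIsometryOfStrictConvexSpace
  have hφ : Function.Surjective φ := by
    have h1 : Function.Surjective φ.linearIsometry :=
      (LinearMap.injective_iff_surjective (f := φ.linearIsometry.toLinearMap)).1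
        φ.linearIsometry.injective
    intro y
    obtain ⟨v, hv⟩ := h1 (y -ᵥ φ 0)
    refine ⟨v +ᵥ (0 : EuclideanSpace ℝ (Fin N)), ?_⟩
    rw [φ.map_vadd, hv, vsub_vadd]
  intro y
  obtain ⟨x, hx⟩ := hφ ((F.ratio i)⁻¹ • y)
  exact ⟨x, smul_right_injective _ (inv_ne_zero (F.ratio_pos i).ne') hx⟩

theorem wWord_surjective (σ : List (Fin k)) : Function.Surjective (F.wWord σ) := by
  induction σ with
  | nil => exact Function.surjective_id
  | cons i σ ih => exact (F.w_surjective i).comp ih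

theorem wWord_image_subset {U : Set (EuclideanSpace ℝ (Fin N))} (hU : ∀ i, F.w i '' U ⊆ U)
    (σ : List (Fin k)) : F.wWord σ '' U ⊆ U := by
  induction σ with
  | nil => simp [wWord]
  | cons i σ ih =>
    rw [wWord, Set.image_comp]
    exact (Set.image_mono ih).trans (hU i)

/-- A common first letter is cancelled by injectivity; at the first differing letter the images lie
in the disjoint sets w_i(U) and w_j(U). -/
theorem disjoint_wWord_image {U : Set (EuclideanSpace ℝ (Fin N))} (hU : ∀ i, F.w i '' U ⊆ U)
    (hd : ∀ i j, i ≠ j → Disjoint (F.w i '' U) (F.w j '' U)) {σ τ : List (Fin k)}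
    (hl : σ.length = τ.length) (hne : σ ≠ τ) :
    Disjoint (F.wWord σ '' U) (F.wWord τ '' U) := by
  induction σ generalizing τ with
  | nil => exact absurd (List.length_eq_zero_iff.1 hl.symm).symm hne
  | cons i σ ih =>
    cases τ with
    | nil => simp at hl
    | cons j τ =>
      simp only [wWord, Set.image_comp]
      by_cases hij : i = j
      · subst hij
        have hinj : Function.Injective (F.w i) := F.wWord_injective [i]
        exact (Set.disjoint_image_iff hinj).2
          (ih (by simpa using hl) fun h => hne (by rw [h]))
      · exact (hd i j hij).mono (Set.image_mono (F.wWord_image_subset hU σ))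
          (Set.image_mono (F.wWord_image_subset hU τ))

theorem iUnion_wWord_image_K (n : ℕ) :
    ⋃ τ : Fin n → Fin k, F.wWord (List.ofFn τ) '' F.K = F.K := by
  refine Set.Subset.antisymm (Set.iUnion_subset fun τ => ?_) ?_
  · rintro _ ⟨x, hx, rfl⟩
    exact F.wWord_mem _ hx
  · induction n with
    | zero =>
      intro x hx
      exact Set.mem_iUnion.2 ⟨Fin.elim0, x, hx, by simp [wWord]⟩
    | succ n ih =>
      intro x hx
      rw [F.K_eq] at hx
      obtain ⟨i, y, hy, rfl⟩ := Set.mem_iUnion.1 hx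
      obtain ⟨τ, z, hz, rfl⟩ := Set.mem_iUnion.1 (ih hy)
      refine Set.mem_iUnion.2 ⟨Fin.cons i τ, z, hz, ?_⟩
      rw [List.ofFn_succ]
      simp [wWord]

variable {F}

namespace IsNested

variable {lam : ℝ}

theorem one_lt_card (hF : F.IsNested lam) : 1 < k := by
  obtain ⟨p, ⟨i, hi, -⟩, q, ⟨j, hj, -⟩, hpq⟩ := hF.nontrivial_V₀
  have hij : i ≠ j := by
    rintro rfl
    exact hpq (F.fixedPoint_unique hi hj)
  have hi := i.isLt
  have hj := j.isLt
  have : (i : ℕ) ≠ j := fun h => hij (Fin.ext h)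
  omega

theorem lam_pos (hF : F.IsNested lam) : 0 < lam := by
  rw [← hF.ratio_eq ⟨0, zero_lt_one.trans hF.one_lt_card⟩]
  exact F.ratio_pos _

theorem lam_lt_one (hF : F.IsNested lam) : lam < 1 := by
  rw [← hF.ratio_eq ⟨0, zero_lt_one.trans hF.one_lt_card⟩]
  exact F.ratio_lt_one _

theorem ratioWord_eq (hF : F.IsNested lam) (σ : List (Fin k)) : F.ratioWord σ = lam ^ σ.length := by
  induction σ with
  | nil => simp [ratioWord]
  | cons i σ ih =>
    rw [ratioWord] at ih ⊢
    rw [List.map_cons, List.prod_cons, ih, hF.ratio_eq, List.length_cons, pow_succ']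

/-- A set of diameter at most `λ ^ n` meets a bounded number of the cells of level `n`. -/
theorem exists_card_cells_le (hF : F.IsNested lam) :
    ∃ C : ℕ, ∀ (n : ℕ) (s : Set (EuclideanSpace ℝ (Fin N))),
    (∀ x ∈ s, ∀ y ∈ s, dist x y ≤ lam ^ n) → ∀ A : Finset (Fin n → Fin k),
      (∀ τ ∈ A, (F.wWord (List.ofFn τ) '' F.K ∩ s).Nonempty) → A.card ≤ C := by
  obtain ⟨U, hUo, -, ⟨u, hu⟩, hU, hUd⟩ := hF.open_set_condition
  obtain ⟨r, hr, hball⟩ := Metric.isOpen_iff.1 hUo u hu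
  obtain ⟨R, hR⟩ := F.isCompact_K.isBounded.subset_closedBall u
  obtain ⟨t, -, htf, ht⟩ := (isCompact_closedBall (0 : EuclideanSpace ℝ (Fin N))
    (R + 1)).finite_cover_balls (half_pos hr)
  refine ⟨htf.toFinset.card, fun n s hs A hA => ?_⟩
  have hl : 0 < lam ^ n := pow_pos hF.lam_pos n
  have hratio : ∀ τ : Fin n → Fin k, F.ratioWord (List.ofFn τ) = lam ^ n := fun τ => by
    rw [hF.ratioWord_eq, List.length_ofFn]
  -- If w_τ(u) were closer than λ^n r to w_σ(u), its preimage under the surjective w_σ would lie in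
  -- the r-ball about u, hence in U, and the images of U would meet.
  have hsep : ∀ σ τ : Fin n → Fin k, σ ≠ τ →
      lam ^ n * r ≤ dist (F.wWord (List.ofFn σ) u) (F.wWord (List.ofFn τ) u) := by
    intro σ τ hne
    by_contra h
    rw [not_le] at h
    obtain ⟨v, hv⟩ := F.wWord_surjective (List.ofFn σ) (F.wWord (List.ofFn τ) u)
    have hvU : v ∈ U := by
      refine hball ?_
      rw [← hv, F.dist_wWord, hratio] at h
      rw [Metric.mem_ball, dist_comm]
      exact lt_of_mul_lt_mul_left h hl.le
    exact Set.disjoint_left.1 (F.disjoint_wWord_image hU hUd (by simp)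
      (fun h => hne (List.ofFn_injective h))) ⟨v, hvU, hv⟩ ⟨u, hu, rfl⟩
  rcases A.eq_empty_or_nonempty with rfl | ⟨σ₀, hσ₀⟩
  · simp
  obtain ⟨z, -, hz⟩ := hA σ₀ hσ₀
  -- Rescaled by λ^{-n} about z, the points w_τ(u) lie in a fixed ball of radius R + 1, which a
  -- number of balls of radius r/2 independent of n covers. By the separation each of these holds at
  -- most one of the points.
  have hmem : ∀ τ ∈ A, ∃ c ∈ htf.toFinset,
      dist ((lam ^ n)⁻¹ • (F.wWord (List.ofFn τ) u - z)) c < r / 2 := by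
    intro τ hτ
    obtain ⟨_, ⟨y, hy, rfl⟩, hys⟩ := hA τ hτ
    have h1 : dist (F.wWord (List.ofFn τ) u) z ≤ lam ^ n * (R + 1) := by
      refine (dist_triangle _ (F.wWord (List.ofFn τ) y) _).trans ?_
      rw [F.dist_wWord, hratio]
      have h2 : dist y u ≤ R := hR hy
      rw [dist_comm] at h2
      have h3 := hs _ hys _ hz
      nlinarith
    have h2 : (lam ^ n)⁻¹ • (F.wWord (List.ofFn τ) u - z) ∈
        Metric.closedBall (0 : EuclideanSpace ℝ (Fin N)) (R + 1) := by
      rw [mem_closedBall_zero_iff, norm_smul, Real.norm_of_nonneg (inv_nonneg.2 hl.le),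
        ← dist_eq_norm, inv_mul_le_iff₀ hl]
      exact h1
    obtain ⟨c, hc, hc'⟩ := Set.mem_iUnion₂.1 (ht h2)
    exact ⟨c, htf.mem_toFinset.2 hc, hc'⟩
  choose! c hct hcd using hmem
  refine Finset.card_le_card_of_injOn c hct fun σ hσ τ hτ hστ => ?_
  by_contra hne
  have h1 := hcd σ hσ
  have h2 := hcd τ hτ
  rw [← hστ] at h2
  have h3 := dist_triangle_right ((lam ^ n)⁻¹ • (F.wWord (List.ofFn σ) u - z))
    ((lam ^ n)⁻¹ • (F.wWord (List.ofFn τ) u - z)) (c σ)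
  rw [dist_smul₀, dist_sub_right, Real.norm_of_nonneg (inv_nonneg.2 hl.le)] at h3
  have h4 := hsep σ τ hne
  rw [mul_comm, ← le_div_iff₀ hl, div_eq_inv_mul] at h4
  linarith

end IsNested

end SelfSimilarFractal

/-! ### The Hausdorff measure of a nested fractal -/

/-- The uniform Bernoulli measure on sequences. -/
theorem exists_uniform_bernoulli {k : ℕ} (hk : 0 < k) :
    ∃ P : MeasureTheory.Measure (ℕ → Fin k), MeasureTheory.IsProbabilityMeasure P ∧
      ∀ (n : ℕ) (τ : Fin n → Fin k), P {ω | ∀ i : Fin n, ω i = τ i} = ((k : ℝ≥0∞) ^ n)⁻¹ := by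
  have : NeZero k := ⟨hk.ne'⟩
  refine ⟨MeasureTheory.Measure.infinitePi fun _ : ℕ =>
    (PMF.uniformOfFintype (Fin k)).toMeasure, inferInstance, fun n τ => ?_⟩
  let t : ℕ → Set (Fin k) := fun i => if h : i < n then {τ ⟨i, h⟩} else Set.univ
  have hset : {ω : ℕ → Fin k | ∀ i : Fin n, ω i = τ i} = Set.pi (Finset.range n : Set ℕ) t := by
    ext ω
    simp only [Set.mem_ofPred_eq, Set.mem_pi, Finset.coe_range, Set.mem_Iio, t]
    constructor
    · intro h i hi
      rw [dif_pos hi]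
      exact h ⟨i, hi⟩
    · intro h i
      have := h i i.2
      rwa [dif_pos i.2] at this
  rw [hset, MeasureTheory.Measure.infinitePi_pi _ fun _ _ => MeasurableSet.of_discrete]
  have hone : ∀ i ∈ Finset.range n,
      (PMF.uniformOfFintype (Fin k)).toMeasure (t i) = (k : ℝ≥0∞)⁻¹ := by
    intro i hi
    have : t i = {τ ⟨i, Finset.mem_range.1 hi⟩} := dif_pos (Finset.mem_range.1 hi)
    rw [this, PMF.toMeasure_apply_singleton _ _ MeasurableSet.of_discrete,
      PMF.uniformOfFintype_apply, Fintype.card_fin]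
  rw [Finset.prod_congr rfl hone, Finset.prod_const, Finset.card_range, ENNReal.inv_pow]

namespace SelfSimilarFractal

open MeasureTheory

variable {N k : ℕ} {F : SelfSimilarFractal N k}

namespace IsNested

variable {lam : ℝ}

theorem log_card_pos (hF : F.IsNested lam) :
    0 < Real.log k := Real.log_pos (by exact_mod_cast hF.one_lt_card)

theorem log_one_div_pos (hF : F.IsNested lam) : 0 < Real.log (1 / lam) :=
  Real.log_pos (one_lt_one_div hF.lam_pos hF.lam_lt_one)

theorem lam_rpow_eq (hF : F.IsNested lam) {d : ℝ} (hd : d = Real.log k / Real.log (1 / lam)) :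
    lam ^ d = (k : ℝ)⁻¹ := by
  have h := hF.log_one_div_pos
  rw [Real.rpow_def_of_pos hF.lam_pos, hd]
  have h2 : Real.log lam * (Real.log k / Real.log (1 / lam)) = -Real.log k := by
    rw [one_div, Real.log_inv] at h ⊢
    have : Real.log lam ≠ 0 := by linarith
    field_simp
  rw [h2, Real.exp_neg, Real.exp_log]
  exact_mod_cast zero_lt_one.trans hF.one_lt_card

theorem dim_pos (hF : F.IsNested lam)
    {d : ℝ} (hd : d = Real.log k / Real.log (1 / lam)) : 0 < d := by
  rw [hd]
  exact div_pos hF.log_card_pos hF.log_one_div_pos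

theorem ofReal_lam_pow_rpow (hF : F.IsNested lam)
    {d : ℝ} (hd : d = Real.log k / Real.log (1 / lam)) (n : ℕ) :
    ENNReal.ofReal (lam ^ n) ^ d = ((k : ℝ≥0∞) ^ n)⁻¹ := by
  have hk : (0 : ℝ) < k := by exact_mod_cast zero_lt_one.trans hF.one_lt_card
  rw [ENNReal.ofReal_rpow_of_pos (pow_pos hF.lam_pos n), ← Real.rpow_natCast, ← Real.rpow_mul
    hF.lam_pos.le, mul_comm, Real.rpow_mul hF.lam_pos.le, hF.lam_rpow_eq hd, Real.rpow_natCast,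
    inv_pow, ENNReal.ofReal_inv_of_pos (pow_pos hk n), ENNReal.ofReal_pow hk.le,
    ENNReal.ofReal_natCast]

theorem ediam_wWord_image_K_le (hF : F.IsNested lam) (n : ℕ) (τ : Fin n → Fin k) :
    Metric.ediam (F.wWord (List.ofFn τ) '' F.K) ≤
      ENNReal.ofReal (lam ^ n) * Metric.ediam F.K := by
  refine ((F.lipschitzWith_wWord (List.ofFn τ)).ediam_image_le F.K).trans_eq ?_
  rw [hF.ratioWord_eq, List.length_ofFn]
  rfl

/-- The k^n cells of level n cover K, and each has diameter to the power d at most k^{-n} diam(K)^d,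
so the covering sums never exceed diam(K)^d. -/
theorem hausdorffMeasure_K_lt_top (hF : F.IsNested lam)
    {d : ℝ} (hd : d = Real.log k / Real.log (1 / lam)) :
    μH[d] F.K < ⊤ := by
  have hdiam : Metric.ediam F.K ≠ ⊤ := F.isCompact_K.isBounded.ediam_ne_top
  have hk : (k : ℝ≥0∞) ≠ 0 := by exact_mod_cast (zero_lt_one.trans hF.one_lt_card).ne'
  have h := MeasureTheory.Measure.hausdorffMeasure_le_liminf_sum (ι := fun n => Fin n → Fin k) d F.K
    (l := Filter.atTop) (fun n : ℕ => ENNReal.ofReal (lam ^ n) * Metric.ediam F.K) ?_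
    (fun n τ => F.wWord (List.ofFn τ) '' F.K)
    (Filter.Eventually.of_forall hF.ediam_wWord_image_K_le)
    (Filter.Eventually.of_forall fun n => (F.iUnion_wWord_image_K n).superset)
  · refine lt_of_le_of_lt h ?_
    have h2 : ∀ n : ℕ, ∑ τ : Fin n → Fin k,
        Metric.ediam (F.wWord (List.ofFn τ) '' F.K) ^ d ≤ Metric.ediam F.K ^ d := by
      intro n
      refine (Finset.sum_le_sum fun τ _ => ENNReal.rpow_le_rpow (hF.ediam_wWord_image_K_le n τ)
        (hF.dim_pos hd).le).trans ?_
      rw [Finset.sum_const, Finset.card_univ, Fintype.card_fun, Fintype.card_fin, Fintype.card_fin,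
        nsmul_eq_mul, ENNReal.mul_rpow_of_nonneg _ _ (hF.dim_pos hd).le, hF.ofReal_lam_pow_rpow hd,
        Nat.cast_pow, ← mul_assoc, ENNReal.mul_inv_cancel (pow_ne_zero n hk)
          (ENNReal.pow_ne_top (ENNReal.natCast_ne_top k)), one_mul]
    refine lt_of_le_of_lt (Filter.liminf_le_of_le (by isBoundedDefault)
      (a := Metric.ediam F.K ^ d) fun b hb => ?_)
      (ENNReal.rpow_lt_top_of_nonneg (hF.dim_pos hd).le hdiam)
    obtain ⟨n, hn⟩ := hb.exists
    exact hn.trans (h2 n)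
  · have h1 : Filter.Tendsto (fun n : ℕ => ENNReal.ofReal (lam ^ n)) Filter.atTop (nhds 0) := by
      rw [← ENNReal.ofReal_zero]
      exact ENNReal.tendsto_ofReal
        (tendsto_pow_atTop_nhds_zero_of_lt_one hF.lam_pos.le hF.lam_lt_one)
    simpa using ENNReal.Tendsto.mul_const h1 (Or.inr hdiam)

/-- The coding map from sequences to the fractal. -/
theorem exists_coding (hF : F.IsNested lam) :
    ∃ π : (ℕ → Fin k) → EuclideanSpace ℝ (Fin N), Measurable π ∧
    ∀ (ω : ℕ → Fin k) (n : ℕ), π ω ∈ F.wWord (List.ofFn fun i : Fin n => ω i) '' F.K := by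
  obtain ⟨x₀, hx₀⟩ := F.nonempty_K
  let u : ℕ → (ℕ → Fin k) → EuclideanSpace ℝ (Fin N) := fun n ω =>
    F.wWord (List.ofFn fun i : Fin n => ω i) x₀
  have hsucc : ∀ (ω : ℕ → Fin k) (n : ℕ), F.wWord (List.ofFn fun i : Fin (n + 1) => ω i) =
      F.wWord (List.ofFn fun i : Fin n => ω i) ∘ F.w (ω n) := by
    intro ω n
    rw [List.ofFn_succ_last, F.wWord_append]
    rfl
  obtain ⟨C, hC⟩ := (Metric.isBounded_iff.1 F.isCompact_K.isBounded)
  have hdist : ∀ ω n, dist (u n ω) (u (n + 1) ω) ≤ C * lam ^ n := by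
    intro ω n
    simp only [u, hsucc, Function.comp_apply]
    rw [F.dist_wWord, hF.ratioWord_eq, List.length_ofFn, mul_comm]
    exact mul_le_mul_of_nonneg_right (hC hx₀ (F.w_mem hx₀)) (pow_pos hF.lam_pos n).le
  have hlim : ∀ ω, ∃ x, Filter.Tendsto (fun n => u n ω) Filter.atTop (nhds x) := fun ω =>
    cauchySeq_tendsto_of_complete (cauchySeq_of_le_geometric lam C hF.lam_lt_one (hdist ω))
  choose π hπ using hlim
  refine ⟨π, ?_, fun ω n => ?_⟩
  · refine measurable_of_tendsto_metrizable (f := u) (fun n => ?_) (tendsto_pi_nhds.2 hπ)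
    have h1 : Measurable fun (ω : ℕ → Fin k) (i : Fin n) => ω i :=
      measurable_pi_lambda _ fun i => measurable_pi_apply _
    have h2 : Measurable fun τ : Fin n → Fin k => F.wWord (List.ofFn τ) x₀ := measurable_of_finite _
    exact h2.comp h1
  · have hsub : ∀ m, F.wWord (List.ofFn fun i : Fin (n + m) => ω i) '' F.K ⊆
        F.wWord (List.ofFn fun i : Fin n => ω i) '' F.K := by
      intro m
      induction m with
      | zero => exact subset_rfl
      | succ m ih =>
        refine Set.Subset.trans ?_ ih
        rw [← Nat.add_assoc, hsucc, Set.image_comp]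
        refine Set.image_mono ?_
        rintro _ ⟨x, hx, rfl⟩
        exact F.w_mem hx
    refine (F.isCompact_K.image (F.lipschitzWith_wWord _).continuous).isClosed.mem_of_tendsto (hπ ω)
      ?_
    filter_upwards [Filter.eventually_ge_atTop n] with m hm
    obtain ⟨j, rfl⟩ := Nat.exists_eq_add_of_le hm
    exact hsub j ⟨x₀, hx₀, rfl⟩

/-- Mass distribution principle: the image of the Bernoulli measure gives a set s of diameter at
most 1 mass at most c diam(s)^d, hence c⁻¹ times it is a lower bound for the Hausdorff measure. -/
theorem hausdorffMeasure_K_pos (hF : F.IsNested lam)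
    {d : ℝ} (hd : d = Real.log k / Real.log (1 / lam)) :
    0 < μH[d] F.K := by
  classical
  have hk0 : 0 < k := zero_lt_one.trans hF.one_lt_card
  have hk : (k : ℝ≥0∞) ≠ 0 := by exact_mod_cast hk0.ne'
  have hkt : (k : ℝ≥0∞) ≠ ⊤ := ENNReal.natCast_ne_top k
  have hd0 := hF.dim_pos hd
  obtain ⟨P, hP, hcyl⟩ := exists_uniform_bernoulli hk0
  obtain ⟨π, hπ, hmem⟩ := hF.exists_coding
  obtain ⟨C, hC⟩ := hF.exists_card_cells_le
  -- At most C cells of level n meet s, and each corresponds to a cylinder of mass k^{-n}.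
  have hbound : ∀ (n : ℕ) (s : Set (EuclideanSpace ℝ (Fin N))),
      Metric.ediam s ≤ ENNReal.ofReal (lam ^ n) → P (π ⁻¹' s) ≤ C * ((k : ℝ≥0∞) ^ n)⁻¹ := by
    intro n s hs
    let A : Finset (Fin n → Fin k) :=
      Finset.univ.filter fun τ => (F.wWord (List.ofFn τ) '' F.K ∩ s).Nonempty
    have hA : A.card ≤ C := by
      refine hC n s (fun x hx y hy => ?_) A fun τ hτ => (Finset.mem_filter.1 hτ).2
      have h1 := (Metric.edist_le_ediam_of_mem hx hy).trans hs
      rw [edist_dist] at h1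
      exact (ENNReal.ofReal_le_ofReal_iff (pow_pos hF.lam_pos n).le).1 h1
    have hsub : π ⁻¹' s ⊆ ⋃ τ ∈ A, {ω | ∀ i : Fin n, ω i = τ i} := by
      intro ω hω
      exact Set.mem_iUnion₂.2 ⟨fun i => ω i, Finset.mem_filter.2 ⟨Finset.mem_univ _,
        π ω, hmem ω n, hω⟩, fun i => rfl⟩
    refine (measure_mono hsub).trans ((measure_biUnion_finset_le _ _).trans ?_)
    rw [Finset.sum_congr rfl fun τ _ => hcyl n τ, Finset.sum_const, nsmul_eq_mul]
    gcongr
  have hC0 : C ≠ 0 := by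
    rintro rfl
    obtain ⟨x, hx⟩ := F.nonempty_K
    have h3 := hC 0 {x} (by simp) {Fin.elim0} (by
      intro τ _
      refine ⟨x, ⟨x, hx, ?_⟩, rfl⟩
      simp [wWord])
    simp at h3
  -- The factor k pays for rounding the diameter to the scale λ^(n+1) < diam ≤ λ^n.
  let c : ℝ≥0∞ := C * k
  have hc0 : c ≠ 0 := mul_ne_zero (by exact_mod_cast hC0) hk
  have hct : c ≠ ⊤ := ENNReal.mul_ne_top (ENNReal.natCast_ne_top C) hkt
  have hmass : ∀ s : Set (EuclideanSpace ℝ (Fin N)), Metric.ediam s ≤ 1 →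
      P (π ⁻¹' s) ≤ c * Metric.ediam s ^ d := by
    intro s hs
    have hst : Metric.ediam s ≠ ⊤ := ne_top_of_le_ne_top ENNReal.one_ne_top hs
    -- Diameter 0 fits every scale; letting n → ∞ shows that the mass is 0.
    rcases eq_or_ne (Metric.ediam s) 0 with h0 | h0
    · have h1 : P (π ⁻¹' s) ≤ 0 := by
        have h2 : Filter.Tendsto (fun n : ℕ => (C : ℝ≥0∞) * ((k : ℝ≥0∞) ^ n)⁻¹) Filter.atTop
            (nhds 0) := by
          have h3 : Filter.Tendsto (fun n : ℕ => ((k : ℝ≥0∞)⁻¹) ^ n) Filter.atTop (nhds 0) :=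
            ENNReal.tendsto_pow_atTop_nhds_zero_of_lt_one
              (ENNReal.inv_lt_one.2 (by exact_mod_cast hF.one_lt_card))
          simp only [ENNReal.inv_pow]
          simpa using ENNReal.Tendsto.const_mul h3 (Or.inr (ENNReal.natCast_ne_top C))
        exact ge_of_tendsto' h2 fun n => hbound n s (by rw [h0]; exact zero_le)
      exact h1.trans zero_le
    · have hx : 0 < (Metric.ediam s).toReal := ENNReal.toReal_pos h0 hst
      have hx1 : (Metric.ediam s).toReal ≤ 1 := by
        simpa using ENNReal.toReal_mono ENNReal.one_ne_top hs
      obtain ⟨n, hn1, hn2⟩ := exists_nat_pow_near_of_lt_one hx hx1 hF.lam_pos hF.lam_lt_one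
      have h1 := hbound n s (by
        rw [← ENNReal.ofReal_toReal hst]
        exact ENNReal.ofReal_le_ofReal hn2)
      refine h1.trans ?_
      have h2 : ENNReal.ofReal (lam ^ (n + 1)) ^ d ≤ Metric.ediam s ^ d := by
        refine ENNReal.rpow_le_rpow ?_ hd0.le
        rw [← ENNReal.ofReal_toReal hst]
        exact ENNReal.ofReal_le_ofReal hn1.le
      rw [hF.ofReal_lam_pow_rpow hd] at h2
      refine le_trans (le_of_eq ?_) (mul_le_mul_right h2 c)
      simp only [c]
      rw [ENNReal.inv_pow, ENNReal.inv_pow, pow_succ', mul_assoc, ← mul_assoc (k : ℝ≥0∞),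
        ENNReal.mul_inv_cancel hk hkt, one_mul]
  have hle : c⁻¹ • P.map π ≤ μH[d] := by
    refine Measure.le_hausdorffMeasure d _ 1 one_pos fun s hs => ?_
    rw [Measure.smul_apply, smul_eq_mul]
    -- An arbitrary s is replaced by its closure, which is measurable and has the same diameter.
    refine (mul_le_mul_right (measure_mono subset_closure) _).trans ?_
    rw [Measure.map_apply hπ isClosed_closure.measurableSet]
    have h1 := hmass (closure s) (by rwa [Metric.ediam_closure])
    rw [Metric.ediam_closure] at h1
    refine (mul_le_mul_right h1 _).trans_eq ?_
    rw [← mul_assoc, ENNReal.inv_mul_cancel hc0 hct, one_mul]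
  refine lt_of_lt_of_le ?_ (hle F.K)
  have hK : π ⁻¹' F.K = Set.univ := by
    refine Set.eq_univ_of_forall fun ω => ?_
    obtain ⟨x, hx, h⟩ := hmem ω 0
    rw [Set.mem_preimage, ← h]
    exact F.wWord_mem _ hx
  rw [Measure.smul_apply, Measure.map_apply hπ F.isCompact_K.isClosed.measurableSet,
    hK, measure_univ,
    smul_eq_mul, mul_one]
  exact ENNReal.inv_pos.2 hct

/-- A similarity is Lipschitz and antilipschitz with reciprocal constants, which gives the two
inequalities. -/
theorem hausdorffMeasure_wWord_image_K (hF : F.IsNested lam)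
    {d : ℝ} (hd : d = Real.log k / Real.log (1 / lam)) (n : ℕ)
    (τ : Fin n → Fin k) :
    μH[d] (F.wWord (List.ofFn τ) '' F.K) = ((k : ℝ≥0∞) ^ n)⁻¹ * μH[d] F.K := by
  have hd0 := hF.dim_pos hd
  have hk : (k : ℝ≥0∞) ≠ 0 := by exact_mod_cast (zero_lt_one.trans hF.one_lt_card).ne'
  have hkt : (k : ℝ≥0∞) ≠ ⊤ := ENNReal.natCast_ne_top k
  have hr : F.ratioWord (List.ofFn τ) = lam ^ n := by rw [hF.ratioWord_eq, List.length_ofFn]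
  have hl := pow_pos hF.lam_pos n
  have hpow : ((lam ^ n).toNNReal : ℝ≥0∞) ^ d = ((k : ℝ≥0∞) ^ n)⁻¹ := hF.ofReal_lam_pow_rpow hd n
  refine le_antisymm ?_ ?_
  · have h := (F.lipschitzWith_wWord (List.ofFn τ)).hausdorffMeasure_image_le hd0.le F.K
    rwa [hr, hpow] at h
  · have h := (F.antilipschitzWith_wWord (List.ofFn τ)).le_hausdorffMeasure_image hd0.le F.K
    rw [hr, Real.toNNReal_inv, ENNReal.coe_inv (by simpa using hl), ENNReal.inv_rpow, hpow,
      inv_inv] at h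
    refine (mul_le_mul_right h _).trans_eq ?_
    rw [← mul_assoc, ENNReal.inv_mul_cancel (pow_ne_zero n hk) (ENNReal.pow_ne_top hkt), one_mul]

theorem isProbabilityMeasure_normalizedHausdorff (hF : F.IsNested lam) {d : ℝ}
    (hd : d = Real.log k / Real.log (1 / lam)) :
    IsProbabilityMeasure (F.normalizedHausdorff d) := by
  constructor
  rw [normalizedHausdorff, Measure.smul_apply,
    comap_subtype_coe_apply F.isCompact_K.isClosed.measurableSet, Set.image_univ, Subtype.range_coe,
    smul_eq_mul]
  exact ENNReal.inv_mul_cancel (hF.hausdorffMeasure_K_pos hd).ne'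
        (hF.hausdorffMeasure_K_lt_top hd).ne

/-- Averages over the vertices of the cells of level `n` converge to the integral. -/
theorem tendsto_average (hF : F.IsNested lam)
    {d : ℝ} (hd : d = Real.log k / Real.log (1 / lam)) (f : C(F.K, ℝ))
    (p : F.K) : Filter.Tendsto (fun n : ℕ => ((k : ℝ) ^ n)⁻¹ * ∑ τ : Fin n → Fin k,
      f ⟨F.wWord (List.ofFn τ) p, F.wWord_mem _ p.2⟩) Filter.atTop
      (nhds (∫ x, f x ∂(F.normalizedHausdorff d))) := by
  have hcompact : CompactSpace F.K := isCompact_iff_compactSpace.1 F.isCompact_K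
  have hprob := hF.isProbabilityMeasure_normalizedHausdorff hd
  have hKm : MeasurableSet F.K := F.isCompact_K.isClosed.measurableSet
  have hd0 := hF.dim_pos hd
  have := Measure.nullSingletonClass_hausdorff (X := EuclideanSpace ℝ (Fin N)) hd0
  have hcellm : ∀ (n : ℕ) (τ : Fin n → Fin k),
      MeasurableSet ((↑) ⁻¹' (F.wWord (List.ofFn τ) '' F.K) : Set F.K) := fun n τ =>
    measurable_subtype_coe
      (F.isCompact_K.image (F.lipschitzWith_wWord _).continuous).isClosed.measurableSet
  have hcell : ∀ (n : ℕ) (τ : Fin n → Fin k),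
      (F.normalizedHausdorff d).real ((↑) ⁻¹' (F.wWord (List.ofFn τ) '' F.K)) =
        ((k : ℝ) ^ n)⁻¹ := by
    intro n τ
    rw [measureReal_def, normalizedHausdorff, Measure.smul_apply, comap_subtype_coe_apply hKm,
      Subtype.image_preimage_coe, Set.inter_eq_right.2 (by
        rintro _ ⟨x, hx, rfl⟩
        exact F.wWord_mem _ hx), hF.hausdorffMeasure_wWord_image_K hd, smul_eq_mul, mul_left_comm,
      ENNReal.inv_mul_cancel (hF.hausdorffMeasure_K_pos hd).ne'
        (hF.hausdorffMeasure_K_lt_top hd).ne,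
      mul_one]
    simp
  have hint : ∀ s : Set F.K, IntegrableOn f s (F.normalizedHausdorff d) := fun s =>
    (f.continuous.integrable_of_hasCompactSupport
      (HasCompactSupport.of_compactSpace f)).integrableOn
  have hsplit : ∀ n : ℕ, ∫ x, f x ∂(F.normalizedHausdorff d) = ∑ τ : Fin n → Fin k,
      ∫ x in ((↑) ⁻¹' (F.wWord (List.ofFn τ) '' F.K) : Set F.K), f x
        ∂(F.normalizedHausdorff d) := by
    intro n
    have hU : (⋃ τ : Fin n → Fin k, ((↑) ⁻¹' (F.wWord (List.ofFn τ) '' F.K) : Set F.K)) =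
        Set.univ := by
      rw [← Set.preimage_iUnion, F.iUnion_wWord_image_K n]
      exact Subtype.coe_preimage_self F.K
    have h := integral_iUnion_ae (μ := F.normalizedHausdorff d) (f := f)
      (s := fun τ : Fin n → Fin k => ((↑) ⁻¹' (F.wWord (List.ofFn τ) '' F.K) : Set F.K))
      (fun τ => (hcellm n τ).nullMeasurableSet) ?_ (hint _)
    · rw [hU, Measure.restrict_univ, tsum_fintype] at h
      exact h
    · intro σ τ hne
      have h1 := (hF.nesting (List.ofFn σ) (List.ofFn τ) (by simp)
        fun h => hne (List.ofFn_injective h)).2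
      have h2 : μH[d] ((F.wWord (List.ofFn σ) '' F.K) ∩ (F.wWord (List.ofFn τ) '' F.K)) = 0 := by
        rw [h1]
        exact ((F.finite_V₀.image _).inter_of_left _).measure_zero _
      rw [Function.onFun, AEDisjoint, ← Set.preimage_inter, normalizedHausdorff, Measure.smul_apply,
        comap_subtype_coe_apply hKm, Subtype.image_preimage_coe,
        measure_mono_null Set.inter_subset_right h2, smul_zero]
  obtain ⟨C, hC⟩ := (Metric.isBounded_iff.1 F.isCompact_K.isBounded)
  rw [Metric.tendsto_nhds]
  intro ε hε
  obtain ⟨δ, hδ, hf⟩ := Metric.uniformContinuous_iff.1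
    (CompactSpace.uniformContinuous_of_continuous f.continuous) (ε / 2) (half_pos hε)
  have hsmall : Filter.Tendsto (fun n : ℕ => lam ^ n * C) Filter.atTop (nhds 0) := by
    simpa using (tendsto_pow_atTop_nhds_zero_of_lt_one hF.lam_pos.le hF.lam_lt_one).mul_const C
  filter_upwards [hsmall.eventually_lt_const hδ] with n hn
  have hkn : (0 : ℝ) < (k : ℝ) ^ n := by
    have : (0 : ℝ) < k := by exact_mod_cast zero_lt_one.trans hF.one_lt_card
    positivity
  rw [hsplit n, Finset.mul_sum, dist_comm, dist_eq_norm, ← Finset.sum_sub_distrib]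
  have hterm : ∀ τ : Fin n → Fin k, ‖∫ x in ((↑) ⁻¹' (F.wWord (List.ofFn τ) '' F.K) : Set F.K), f x
      ∂(F.normalizedHausdorff d) - ((k : ℝ) ^ n)⁻¹ *
        f ⟨F.wWord (List.ofFn τ) p, F.wWord_mem _ p.2⟩‖ ≤ ε / 2 * ((k : ℝ) ^ n)⁻¹ := by
    intro τ
    -- The sample value is the integral of a constant over its cell, where f oscillates by less than
    -- ε/2 once λ^n C < δ.
    have h1 : ((k : ℝ) ^ n)⁻¹ * f ⟨F.wWord (List.ofFn τ) p, F.wWord_mem _ p.2⟩ =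
        ∫ x in ((↑) ⁻¹' (F.wWord (List.ofFn τ) '' F.K) : Set F.K),
          f ⟨F.wWord (List.ofFn τ) p, F.wWord_mem _ p.2⟩ ∂(F.normalizedHausdorff d) := by
      rw [setIntegral_const, hcell, smul_eq_mul]
    rw [h1, ← integral_sub (hint _) (integrable_const _), ← hcell n τ]
    refine norm_setIntegral_le_of_norm_le_const (measure_lt_top _ _) ?_
    rintro x ⟨y, hy, hyx⟩
    rw [← dist_eq_norm]
    refine (hf ?_).le
    rw [Subtype.dist_eq, ← hyx, F.dist_wWord, hF.ratioWord_eq, List.length_ofFn]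
    exact lt_of_le_of_lt (mul_le_mul_of_nonneg_left (hC hy p.2) (pow_pos hF.lam_pos n).le) hn
  refine lt_of_le_of_lt ((norm_sum_le _ _).trans (Finset.sum_le_sum fun τ _ => hterm τ)) ?_
  rw [Finset.sum_const, Finset.card_univ, Fintype.card_fun, Fintype.card_fin, Fintype.card_fin,
    nsmul_eq_mul, Nat.cast_pow, mul_left_comm, mul_inv_cancel₀ hkn.ne', mul_one]
  exact half_lt_self hε

end IsNested

end SelfSimilarFractal

/-! ### The Dirac operator -/

theorem exists_lp_comp_perm {ι : Type*} (e : Equiv.Perm ι) :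
    ∃ P : lp (fun _ : ι => ℂ) 2 →L[ℂ] lp (fun _ : ι => ℂ) 2, ∀ ξ x, P ξ x = ξ (e x) := by
  have hmem : ∀ ξ : lp (fun _ : ι => ℂ) 2, Memℓp (fun x => ξ (e x)) 2 := by
    intro ξ
    rw [memℓp_gen_iff (by norm_num)]
    exact e.summable_iff.2 ((memℓp_gen_iff (by norm_num)).1 (lp.memℓp ξ))
  refine ⟨LinearMap.mkContinuous
    { toFun := fun ξ => ⟨fun x => ξ (e x), hmem ξ⟩
      map_add' := fun _ _ => rfl
      map_smul' := fun _ _ => rfl } 1 fun ξ => ?_, fun _ _ => rfl⟩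
  rw [one_mul]
  refine le_of_eq ?_
  rw [lp.norm_eq_tsum_rpow (by norm_num), lp.norm_eq_tsum_rpow (by norm_num)]
  congr 1
  exact e.tsum_eq (fun x => ‖ξ x‖ ^ (2 : ℝ≥0∞).toReal)

namespace SelfSimilarFractal

variable {N k : ℕ} (F : SelfSimilarFractal N k)

/-- The standard basis of the Hilbert space of the spectral triple. -/
noncomputable def basis : HilbertBasis F.Index ℂ F.Hilb :=
  HilbertBasis.ofRepr (LinearIsometryEquiv.refl ℂ F.Hilb)

/-- Reversal of the orientation of an edge. -/
def revIndex (x : F.Index) : F.Index := (x.1, x.2.rev)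

theorem revIndex_involutive : Function.Involutive F.revIndex := fun _ => rfl

theorem indexLen_revIndex (x : F.Index) : F.indexLen (F.revIndex x) = F.indexLen x := by
  simp only [indexLen, revIndex, Edge.len, Edge.rev, dist_comm]

theorem Edge.len_pos {F : SelfSimilarFractal N k} (e : F.Edge) : 0 < e.len :=
  dist_pos.2 e.2.2.2

theorem indexLen_pos (x : F.Index) : 0 < F.indexLen x :=
  mul_pos (F.ratioWord_pos x.1) x.2.len_pos

theorem ratioWord_le_one (σ : List (Fin k)) : F.ratioWord σ ≤ 1 := by
  induction σ with
  | nil => simp [ratioWord]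
  | cons i σ ih =>
    rw [ratioWord, List.map_cons, List.prod_cons]
    exact mul_le_one₀ (F.ratio_lt_one i).le (F.ratioWord_pos σ).le ih

theorem indexLen_le (x : F.Index) : F.indexLen x ≤ ∑ e : F.Edge, e.len := by
  have h1 : x.2.len ≤ ∑ e : F.Edge, e.len :=
    Finset.single_le_sum (f := fun e : F.Edge => e.len) (fun e _ => e.len_pos.le)
      (Finset.mem_univ x.2)
  refine le_trans ?_ h1
  exact mul_le_of_le_one_left x.2.len_pos.le (F.ratioWord_le_one x.1)

/-- The inverse is reversal of edges followed by multiplication by the lengths, which are bounded.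
Its range is the whole domain of D because that domain is maximal. -/
theorem exists_isBoundedInverse_dirac : ∃ B : F.Hilb →L[ℂ] F.Hilb, IsBoundedInverse F.dirac B ∧
    ∀ ξ x, B ξ x = F.indexLen x * ξ (F.revIndex x) := by
  obtain ⟨P, hP⟩ := exists_lp_comp_perm (F.revIndex_involutive.toPerm F.revIndex)
  obtain ⟨T, hT, -⟩ := exists_isDiag F.basis (a := fun x => (F.indexLen x : ℂ))
    (C := ∑ e : F.Edge, e.len) (Finset.sum_nonneg fun e _ => e.len_pos.le) (fun x => by
      rw [Complex.norm_real, Real.norm_of_nonneg (F.indexLen_pos x).le]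
      exact F.indexLen_le x)
  have hB : ∀ ξ x, (T ∘L P) ξ x = F.indexLen x * ξ (F.revIndex x) := by
    intro ξ x
    have h1 := hT (P ξ) x
    have h2 := hP ξ x
    exact h1.trans (congrArg _ h2)
  refine ⟨T ∘L P, ?_, hB⟩
  have hne : ∀ x, (F.indexLen x : ℂ) ≠ 0 := fun x => by exact_mod_cast (F.indexLen_pos x).ne'
  rintro ⟨ξ, η⟩
  rw [LinearPMap.mem_graph_iff]
  constructor
  · rintro ⟨ζ, h1, h2⟩
    have h1 : (ζ : F.Hilb) = ξ := h1
    have h2 : F.dirac ζ = η := h2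
    have h3 : ∀ x, η x = ((F.indexLen x)⁻¹ : ℝ) * ξ (F.revIndex x) := by
      intro x
      rw [← h2, ← h1]
      rfl
    refine lp.ext (funext fun x => ?_)
    refine (hB η x).trans ?_
    rw [h3, F.revIndex_involutive x, F.indexLen_revIndex, Complex.ofReal_inv,
      mul_inv_cancel_left₀ (hne x)]
  · intro h
    have h : (T ∘L P) η = ξ := h
    have h3 : ∀ x, (((F.indexLen x)⁻¹ : ℝ) : ℂ) * ξ (x.1, x.2.rev) = η x := by
      intro x
      rw [← h]
      have h4 := hB η (F.revIndex x)
      rw [F.revIndex_involutive x, F.indexLen_revIndex] at h4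
      refine (congrArg _ h4).trans ?_
      rw [Complex.ofReal_inv, inv_mul_cancel_left₀ (hne x)]
    have hmem : ξ ∈ F.dirac.domain := by
      have h5 : Memℓp (fun x => η x) 2 := lp.memℓp η
      exact (congrArg (fun f => Memℓp f 2) (funext h3)).mpr h5
    exact ⟨⟨ξ, hmem⟩, rfl, lp.ext (funext h3)⟩

theorem isDiag_absNegPow_dirac {s : ℂ} (hs : 0 < s.re) :
    IsDiag F.basis (absNegPow F.dirac s) (fun x => (F.indexLen x : ℂ) ^ s) := by
  obtain ⟨B, hB, hBx⟩ := F.exists_isBoundedInverse_dirac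
  exact isDiag_absNegPow hB F.revIndex_involutive F.indexLen_revIndex hBx
    (fun x => (F.indexLen_pos x).le) (Finset.sum_nonneg fun e _ => e.len_pos.le) F.indexLen_le hs

theorem isDiag_rep (f : C(F.K, ℂ)) : IsDiag F.basis (F.rep f) (fun x => f (F.indexPoint x)) :=
  fun _ _ => rfl

end SelfSimilarFractal

/-! ### Sums over words -/

theorem length_equivSigmaTuple_symm {α : Type*} (p : Σ n, Fin n → α) :
    (List.equivSigmaTuple.symm p).length = p.1 :=
  List.length_ofFn

/-- Grouping words by length gives the geometric series with terms (kq)^m. -/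
theorem summable_pow_length_iff {k : ℕ} {q : ℝ} (hq : 0 ≤ q) :
    Summable (fun σ : List (Fin k) => q ^ σ.length) ↔ k * q < 1 := by
  have hfib : ∀ m : ℕ, ∑' _τ : Fin m → Fin k, q ^ m = (k * q) ^ m := by
    intro m
    rw [tsum_fintype]
    simp [mul_pow]
  rw [← (List.equivSigmaTuple (α := Fin k)).symm.summable_iff, Function.comp_def]
  simp only [length_equivSigmaTuple_symm]
  rw [summable_sigma_of_nonneg fun p => pow_nonneg hq p.1]
  simp only [hfib]
  rw [summable_geometric_iff_norm_lt_one, Real.norm_of_nonneg (by positivity)]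
  exact ⟨fun h => h.2, fun h => ⟨fun m => (hasSum_fintype _).summable, h⟩⟩

theorem tsum_pow_length {k : ℕ} {z : ℂ} (hz : k * ‖z‖ < 1) :
    ∑' σ : List (Fin k), z ^ σ.length = (1 - k * z)⁻¹ := by
  have hs : Summable (fun σ : List (Fin k) => z ^ σ.length) := by
    refine Summable.of_norm ?_
    simpa only [norm_pow] using (summable_pow_length_iff (norm_nonneg z)).2 hz
  have hs' : Summable fun p : Σ n, Fin n → Fin k => z ^ p.1 := by
    have h := (List.equivSigmaTuple (α := Fin k)).symm.summable_iff.2 hs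
    simpa only [Function.comp_def, length_equivSigmaTuple_symm] using h
  have h1 := (List.equivSigmaTuple (α := Fin k)).symm.tsum_eq fun σ => z ^ σ.length
  simp only [length_equivSigmaTuple_symm] at h1
  have hfib : ∀ m : ℕ, ∑' _τ : Fin m → Fin k, z ^ m = (k * z) ^ m := by
    intro m
    rw [tsum_fintype]
    simp [mul_pow]
  rw [← h1, hs'.tsum_sigma]
  simp only [hfib]
  exact tsum_geometric_of_norm_lt_one (by simpa using hz)

namespace SelfSimilarFractal

variable {N k : ℕ} {F : SelfSimilarFractal N k}

namespace IsNested

variable {lam : ℝ}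

theorem indexLen_cpow (hF : F.IsNested lam) (x : F.Index) (s : ℂ) :
    (F.indexLen x : ℂ) ^ s = ((lam : ℂ) ^ s) ^ x.1.length * (x.2.len : ℂ) ^ s := by
  rw [indexLen, Complex.ofReal_mul, Complex.mul_cpow_ofReal_nonneg (F.ratioWord_pos _).le
    x.2.len_pos.le, hF.ratioWord_eq, Complex.ofReal_pow]
  congr 1
  -- The rule (λ^n)^s = (λ^s)^n needs no branch correction because λ has argument 0.
  have harg : (lam : ℂ).arg = 0 := Complex.arg_ofReal_of_nonneg hF.lam_pos.le
  rw [← Complex.cpow_nat_mul' (by rw [harg, mul_zero]; linarith [Real.pi_pos])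
    (by rw [harg, mul_zero]; exact Real.pi_pos.le), Complex.cpow_nat_mul]

theorem indexLen_rpow (hF : F.IsNested lam) (x : F.Index) (s : ℝ) :
    F.indexLen x ^ s = (lam ^ s) ^ x.1.length * x.2.len ^ s := by
  rw [indexLen, Real.mul_rpow (F.ratioWord_pos _).le x.2.len_pos.le, hF.ratioWord_eq,
    ← Real.rpow_natCast, ← Real.rpow_natCast, ← Real.rpow_mul hF.lam_pos.le,
    ← Real.rpow_mul hF.lam_pos.le, mul_comm s]

theorem nonempty_edge (hF : F.IsNested lam) : Nonempty F.Edge := by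
  obtain ⟨p, hp, q, hq, hpq⟩ := hF.nontrivial_V₀
  exact ⟨⟨(p, q), hp, hq, hpq⟩⟩

theorem card_mul_lam_rpow_lt_one_iff (hF : F.IsNested lam)
    {d : ℝ} (hd : d = Real.log k / Real.log (1 / lam)) (s : ℝ) :
    k * lam ^ s < 1 ↔ d < s := by
  have hk : (0 : ℝ) < k := by exact_mod_cast zero_lt_one.trans hF.one_lt_card
  rw [← lt_div_iff₀' hk, one_div, ← hF.lam_rpow_eq hd,
    Real.rpow_lt_rpow_left_iff_of_base_lt_one hF.lam_pos hF.lam_lt_one]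

theorem summable_norm_indexLen_cpow_iff (hF : F.IsNested lam)
    {d : ℝ} (hd : d = Real.log k / Real.log (1 / lam))
    (s : ℂ) : (Summable fun x : F.Index => ‖(F.indexLen x : ℂ) ^ s‖) ↔ d < s.re := by
  have hq : 0 ≤ lam ^ s.re := (Real.rpow_pos_of_pos hF.lam_pos _).le
  simp only [Complex.norm_cpow_eq_rpow_re_of_pos (F.indexLen_pos _), hF.indexLen_rpow]
  rw [← hF.card_mul_lam_rpow_lt_one_iff hd, ← summable_pow_length_iff hq]
  constructor
  · intro h
    obtain ⟨e⟩ := hF.nonempty_edge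
    -- A single edge, with its nonzero factor ℓ(e)^{Re s}, already isolates the sum over words.
    have h1 := h.comp_injective (i := fun σ : List (Fin k) => (σ, e))
      fun _ _ h => congrArg Prod.fst h
    exact (summable_mul_right_iff (Real.rpow_pos_of_pos e.len_pos s.re).ne').1 h1
  · intro h
    exact h.mul_of_nonneg (hasSum_fintype fun e : F.Edge => e.len ^ s.re).summable
      (fun σ => pow_nonneg hq _) (fun e => Real.rpow_nonneg e.len_pos.le _)

theorem tsum_indexLen_cpow (hF : F.IsNested lam)
    {d : ℝ} (hd : d = Real.log k / Real.log (1 / lam)) {s : ℂ}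
    (hs : d < s.re) :
    ∑' x : F.Index, (F.indexLen x : ℂ) ^ s = F.edgeSum s / (1 - (k : ℂ) * (lam : ℂ) ^ s) := by
  have hz : k * ‖(lam : ℂ) ^ s‖ < 1 := by
    rw [Complex.norm_cpow_eq_rpow_re_of_pos hF.lam_pos]
    exact (hF.card_mul_lam_rpow_lt_one_iff hd _).2 hs
  simp only [hF.indexLen_cpow]
  rw [← tsum_mul_tsum_of_summable_norm
    (f := fun σ : List (Fin k) => ((lam : ℂ) ^ s) ^ σ.length)
    (g := fun e : F.Edge => (e.len : ℂ) ^ s)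
    (by simpa only [norm_pow] using (summable_pow_length_iff (norm_nonneg _)).2 hz)
    (hasSum_fintype _).summable, tsum_pow_length hz, tsum_fintype, edgeSum, mul_comm,
    div_eq_mul_inv]

theorem isTraceClass_absNegPow_dirac_iff (hF : F.IsNested lam)
    {d : ℝ} (hd : d = Real.log k / Real.log (1 / lam)) {s : ℂ}
    (hs : 0 < s.re) : IsTraceClass (absNegPow F.dirac s) ↔ d < s.re :=
  (F.isDiag_absNegPow_dirac hs).isTraceClass_iff.trans (hF.summable_norm_indexLen_cpow_iff hd s)

theorem metricDim_dirac (hF : F.IsNested lam) {d : ℝ} (hd : d = Real.log k / Real.log (1 / lam)) :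
    metricDim F.dirac = d := by
  have h : {s : ℝ | 0 < s ∧ IsTraceClass (absNegPow F.dirac (s : ℂ))} = Set.Ioi d := by
    ext s
    constructor
    · rintro ⟨h1, h2⟩
      simpa using (hF.isTraceClass_absNegPow_dirac_iff hd (by simpa using h1)).1 h2
    · intro h
      have h1 : 0 < s := (hF.dim_pos hd).trans h
      exact ⟨h1, (hF.isTraceClass_absNegPow_dirac_iff hd (by simpa using h1)).2 (by simpa using h)⟩
  rw [metricDim, h, csInf_Ioi]

theorem zetaFun_dirac (hF : F.IsNested lam)
    {d : ℝ} (hd : d = Real.log k / Real.log (1 / lam)) {s : ℂ}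
    (hs : d < s.re) : zetaFun F.dirac s = F.edgeSum s / (1 - (k : ℂ) * (lam : ℂ) ^ s) := by
  rw [← hF.tsum_indexLen_cpow hd hs]
  exact (F.isDiag_absNegPow_dirac ((hF.dim_pos hd).trans hs)).opTrace_eq
    ((hF.summable_norm_indexLen_cpow_iff hd s).2 hs)

end IsNested

end SelfSimilarFractal

/-! ### The noncommutative integral -/

universe u

theorem IsDiag.dixmierTrace_eq {ι H : Type u} [NormedAddCommGroup H] [InnerProductSpace ℂ H]
    [CompleteSpace H] {b : HilbertBasis ι ℂ H} (ω : GeneralizedLimit) {T : H →L[ℂ] H} {a : ι → ℂ}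
    (hT : IsDiag b T a) {l₁ l₂ l₃ l₄ : ℝ}
    (h₁ : ∀ S : H →L[ℂ] H, IsDiag b S (fun x => ((max (a x).re 0 : ℝ) : ℂ)) →
      Filter.Tendsto (logMean S) Filter.atTop (nhds l₁))
    (h₂ : ∀ S : H →L[ℂ] H, IsDiag b S (fun x => ((max (-(a x).re) 0 : ℝ) : ℂ)) →
      Filter.Tendsto (logMean S) Filter.atTop (nhds l₂))
    (h₃ : ∀ S : H →L[ℂ] H, IsDiag b S (fun x => ((max (a x).im 0 : ℝ) : ℂ)) →
      Filter.Tendsto (logMean S) Filter.atTop (nhds l₃))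
    (h₄ : ∀ S : H →L[ℂ] H, IsDiag b S (fun x => ((max (-(a x).im) 0 : ℝ) : ℂ)) →
      Filter.Tendsto (logMean S) Filter.atTop (nhds l₄)) :
    dixmierTrace ω T = ((l₁ - l₂ : ℝ) : ℂ) + Complex.I * ((l₃ - l₄ : ℝ) : ℂ) := by
  obtain ⟨hr, hr'⟩ := hT.realPart.posPart_and_negPart
  obtain ⟨hi, hi'⟩ := hT.imaginaryPart.posPart_and_negPart
  rw [dixmierTrace, dixmierPos_eq_of_tendsto ω (h₁ _ hr), dixmierPos_eq_of_tendsto ω (h₂ _ hr'),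
    dixmierPos_eq_of_tendsto ω (h₃ _ hi), dixmierPos_eq_of_tendsto ω (h₄ _ hi')]

namespace SelfSimilarFractal

open MeasureTheory

variable {N k : ℕ} (F : SelfSimilarFractal N k)

/-- The edges of level less than `n`. -/
noncomputable def indexLT (n : ℕ) : Finset F.Index :=
  (((Finset.range n).sigma fun m => (Finset.univ : Finset (Fin m → Fin k))).map
    (List.equivSigmaTuple (α := Fin k)).symm.toEmbedding) ×ˢ Finset.univ

theorem mem_indexLT {n : ℕ} {x : F.Index} : x ∈ F.indexLT n ↔ x.1.length < n := by
  rw [indexLT, Finset.mem_product, Finset.mem_map_equiv]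
  simp [List.equivSigmaTuple]

theorem sum_indexLT (n : ℕ) (g : F.Index → ℝ) : ∑ x ∈ F.indexLT n, g x =
    ∑ m ∈ Finset.range n, ∑ τ : Fin m → Fin k, ∑ e : F.Edge, g (List.ofFn τ, e) := by
  rw [indexLT, Finset.sum_product, Finset.sum_map, Finset.sum_sigma]
  rfl

theorem card_indexLT_le (hk : 1 < k) (n : ℕ) :
    (F.indexLT n).card ≤ Fintype.card F.Edge * k ^ n := by
  rw [indexLT, Finset.card_product, Finset.card_map, Finset.card_sigma, Finset.card_univ, mul_comm]
  refine Nat.mul_le_mul_left _ ?_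
  simp only [Finset.card_univ, Fintype.card_fun, Fintype.card_fin]
  -- 1 + k + ⋯ + k^(n-1) < k^n, as k ≥ 2.
  exact (Nat.geomSum_lt hk fun m hm => Finset.mem_range.1 hm).le

variable {F}

namespace IsNested

variable {lam : ℝ}

theorem indexLen_rpow_dim (hF : F.IsNested lam)
    {d : ℝ} (hd : d = Real.log k / Real.log (1 / lam)) (x : F.Index) :
    F.indexLen x ^ d = ((k : ℝ) ^ x.1.length)⁻¹ * x.2.len ^ d := by
  rw [hF.indexLen_rpow, hF.lam_rpow_eq hd, inv_pow]

theorem indexLen_rpow_dim_le (hF : F.IsNested lam)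
    {d : ℝ} (hd : d = Real.log k / Real.log (1 / lam)) {n : ℕ}
    {x : F.Index} (hx : x ∉ F.indexLT n) :
    F.indexLen x ^ d ≤ (∑ e : F.Edge, e.len ^ d) / (k : ℝ) ^ n := by
  have hk : (1 : ℝ) ≤ k := by exact_mod_cast hF.one_lt_card.le
  rw [F.mem_indexLT, not_lt] at hx
  rw [hF.indexLen_rpow_dim hd, div_eq_inv_mul]
  refine mul_le_mul ?_ ?_ (Real.rpow_nonneg x.2.len_pos.le _) (by positivity)
  · exact inv_anti₀ (by positivity) (pow_le_pow_right₀ hk hx)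
  · exact Finset.single_le_sum (f := fun e : F.Edge => e.len ^ d)
      (fun e _ => Real.rpow_nonneg e.len_pos.le _) (Finset.mem_univ x.2)

/-- The main asymptotics: `S_n / log n` converges for the operators `g |D|^{-d}` with `g ≥ 0`. -/
theorem tendsto_logMean (hF : F.IsNested lam)
    {d : ℝ} (hd : d = Real.log k / Real.log (1 / lam)) (g : C(F.K, ℝ))
    (hg : ∀ x, 0 ≤ g x) {T : F.Hilb →L[ℂ] F.Hilb}
    (hT : IsDiag F.basis T (fun x => ((g (F.indexPoint x) * F.indexLen x ^ d : ℝ) : ℂ))) :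
    Filter.Tendsto (logMean T) Filter.atTop
      (nhds (1 / Real.log k * (∑ e : F.Edge, e.len ^ d) *
        ∫ x, g x ∂(F.normalizedHausdorff d))) := by
  have hcompact : CompactSpace F.K := isCompact_iff_compactSpace.1 F.isCompact_K
  have hne := hF.nonempty_edge
  have hk := hF.one_lt_card
  have hlen : 0 ≤ ∑ e : F.Edge, e.len ^ d :=
    Finset.sum_nonneg fun e _ => Real.rpow_nonneg e.len_pos.le _
  have hL : Filter.Tendsto (fun n : ℕ =>
      (∑ x ∈ F.indexLT n, g (F.indexPoint x) * F.indexLen x ^ d) / n) Filter.atTop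
      (nhds ((∑ e : F.Edge, e.len ^ d) * ∫ x, g x ∂(F.normalizedHausdorff d))) := by
    -- The contribution of level m alone. The sum over the levels below n, divided by n, is its
    -- Cesàro mean.
    have h1 : Filter.Tendsto (fun m : ℕ => ∑ e : F.Edge, e.len ^ d * (((k : ℝ) ^ m)⁻¹ *
        ∑ τ : Fin m → Fin k, g ⟨F.wWord (List.ofFn τ) e.1.1,
          F.wWord_mem _ (F.V₀_subset e.2.1)⟩)) Filter.atTop
        (nhds (∑ e : F.Edge, e.len ^ d * ∫ x, g x ∂(F.normalizedHausdorff d))) :=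
      tendsto_finsetSum _ fun e _ =>
        (hF.tendsto_average hd g ⟨e.1.1, F.V₀_subset e.2.1⟩).const_mul _
    rw [← Finset.sum_mul] at h1
    refine h1.cesaro.congr fun n => ?_
    rw [div_eq_inv_mul, F.sum_indexLT]
    congr 1
    refine Finset.sum_congr rfl fun m _ => ?_
    rw [Finset.sum_comm]
    refine Finset.sum_congr rfl fun e _ => ?_
    rw [Finset.mul_sum, Finset.mul_sum]
    refine Finset.sum_congr rfl fun τ _ => ?_
    rw [hF.indexLen_rpow_dim hd, List.length_ofFn]
    simp only [indexPoint]
    ring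
  have h := hT.tendsto_logMean
    (fun x => mul_nonneg (hg _) (Real.rpow_nonneg (F.indexLen_pos x).le _))
    hk (Fintype.card_pos (α := F.Edge)) (C := ‖g‖ * ∑ e : F.Edge, e.len ^ d)
    (mul_nonneg (norm_nonneg _) hlen) (F.card_indexLT_le hk) (fun n x hx => ?_) hL
  · convert h using 2
    ring
  · rw [mul_div_assoc]
    exact mul_le_mul ((le_abs_self _).trans (g.norm_coe_le_norm _)) (hF.indexLen_rpow_dim_le hd hx)
      (Real.rpow_nonneg (F.indexLen_pos x).le _) (norm_nonneg _)

theorem isDiag_absNegPow_dirac_dim (hF : F.IsNested lam)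
    {d : ℝ} (hd : d = Real.log k / Real.log (1 / lam)) :
    IsDiag F.basis (absNegPow F.dirac (d : ℂ)) (fun x => ((F.indexLen x ^ d : ℝ) : ℂ)) := by
  have h := F.isDiag_absNegPow_dirac (s := (d : ℂ)) (by simpa using hF.dim_pos hd)
  simpa only [Complex.ofReal_cpow (F.indexLen_pos _).le] using h

theorem inMacaevIdeal_absNegPow_dirac (hF : F.IsNested lam)
    {d : ℝ} (hd : d = Real.log k / Real.log (1 / lam)) :
    InMacaevIdeal (absNegPow F.dirac (d : ℂ)) := by
  have hT := hF.isDiag_absNegPow_dirac_dim hd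
  have hk : (1 : ℝ) < k := by exact_mod_cast hF.one_lt_card
  refine ⟨hT.isCompactOperator ?_, ?_⟩
  · rw [Metric.tendsto_nhds]
    intro ε hε
    have h1 : Filter.Tendsto (fun n : ℕ => (∑ e : F.Edge, e.len ^ d) / (k : ℝ) ^ n) Filter.atTop
        (nhds 0) := (tendsto_pow_atTop_atTop_of_one_lt hk).const_div_atTop _
    obtain ⟨n, hn⟩ := (h1.eventually_lt_const hε).exists
    refine Filter.eventually_cofinite.2 ((F.indexLT n).finite_toSet.subset fun x hx => ?_)
    by_contra hxn
    refine hx ?_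
    rw [dist_zero_right, Complex.norm_real,
      Real.norm_of_nonneg (Real.rpow_nonneg (F.indexLen_pos x).le _)]
    exact lt_of_le_of_lt (hF.indexLen_rpow_dim_le hd hxn) hn
  · refine exists_norm_logMean_le_of_tendsto
      (hF.tendsto_logMean hd (ContinuousMap.const _ 1) (fun _ => zero_le_one) ?_)
    simpa using hT

/-- The weights are nonnegative, so the positive and negative parts of the entries come from those
of Re f and Im f. Each of the four means converges, and the limits recombine by linearity of the
integral. -/
theorem ncIntegral_rep (hF : F.IsNested lam)
    {d : ℝ} (hd : d = Real.log k / Real.log (1 / lam)) (ω : GeneralizedLimit)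
    (f : C(F.K, ℂ)) : ncIntegral F.dirac ω (F.rep f) =
      ((1 / Real.log k * ∑ e : F.Edge, e.len ^ d : ℝ) : ℂ) *
        ∫ x, f x ∂(F.normalizedHausdorff d) := by
  have hcompact : CompactSpace F.K := isCompact_iff_compactSpace.1 F.isCompact_K
  have hprob := hF.isProbabilityMeasure_normalizedHausdorff hd
  have hint : ∀ g : C(F.K, ℝ), Integrable g (F.normalizedHausdorff d) := fun g =>
    g.continuous.integrable_of_hasCompactSupport (HasCompactSupport.of_compactSpace g)
  have hfint : Integrable f (F.normalizedHausdorff d) :=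
    f.continuous.integrable_of_hasCompactSupport (HasCompactSupport.of_compactSpace f)
  let re : C(F.K, ℝ) := ⟨fun x => (f x).re, Complex.continuous_re.comp f.continuous⟩
  let im : C(F.K, ℝ) := ⟨fun x => (f x).im, Complex.continuous_im.comp f.continuous⟩
  have hsub : ∀ g : C(F.K, ℝ), ∫ x, (g ⊔ 0) x ∂(F.normalizedHausdorff d) -
      ∫ x, (-g ⊔ 0) x ∂(F.normalizedHausdorff d) = ∫ x, g x ∂(F.normalizedHausdorff d) := by
    intro g
    rw [← integral_sub (hint _) (hint _)]
    refine integral_congr_ae (Filter.Eventually.of_forall fun x => ?_)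
    simp only [ContinuousMap.sup_apply, ContinuousMap.neg_apply, ContinuousMap.zero_apply]
    rcases le_total 0 (g x) with h | h
    · rw [sup_eq_left.2 h, sup_eq_right.2 (by linarith), sub_zero]
    · rw [sup_eq_right.2 h, sup_eq_left.2 (by linarith)]; ring
  rw [ncIntegral, hF.metricDim_dirac hd]
  have hT := (F.isDiag_rep f).mul (hF.isDiag_absNegPow_dirac_dim hd)
  have hre : ∀ x : F.Index, (f (F.indexPoint x) * ((F.indexLen x ^ d : ℝ) : ℂ)).re =
      re (F.indexPoint x) * F.indexLen x ^ d := fun x => Complex.re_mul_ofReal _ _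
  have him : ∀ x : F.Index, (f (F.indexPoint x) * ((F.indexLen x ^ d : ℝ) : ℂ)).im =
      im (F.indexPoint x) * F.indexLen x ^ d := fun x => Complex.im_mul_ofReal _ _
  have hmax : ∀ (g : C(F.K, ℝ)) (x : F.Index), max (g (F.indexPoint x) * F.indexLen x ^ d) 0 =
      (g ⊔ 0) (F.indexPoint x) * F.indexLen x ^ d := by
    intro g x
    have h0 : 0 ≤ F.indexLen x ^ d := Real.rpow_nonneg (F.indexLen_pos x).le _
    rw [ContinuousMap.sup_apply, ContinuousMap.zero_apply, max_mul_of_nonneg _ _ h0, zero_mul]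
  have hmax' : ∀ (g : C(F.K, ℝ)) (x : F.Index), max (-(g (F.indexPoint x) * F.indexLen x ^ d)) 0 =
      (-g ⊔ 0) (F.indexPoint x) * F.indexLen x ^ d := by
    intro g x
    rw [← hmax, ContinuousMap.neg_apply, neg_mul]
  have hlim : ∀ (g : C(F.K, ℝ)) (c : F.Index → ℝ),
      (∀ x, c x = (g ⊔ 0) (F.indexPoint x) * F.indexLen x ^ d) → ∀ S : F.Hilb →L[ℂ] F.Hilb,
      IsDiag F.basis S (fun x => (c x : ℂ)) → Filter.Tendsto (logMean S) Filter.atTop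
        (nhds (1 / Real.log k * (∑ e : F.Edge, e.len ^ d) *
          ∫ x, (g ⊔ 0) x ∂(F.normalizedHausdorff d))) := by
    intro g c hc S hS
    simp only [hc] at hS
    exact hF.tendsto_logMean hd (g ⊔ 0) (fun x => le_sup_right) hS
  rw [hT.dixmierTrace_eq ω (hlim re _ fun x => by rw [hre, hmax])
    (hlim (-re) _ fun x => by rw [hre, hmax']) (hlim im _ fun x => by rw [him, hmax])
    (hlim (-im) _ fun x => by rw [him, hmax']), ← mul_sub, ← mul_sub, hsub, hsub]
  have hdec : ∫ x, f x ∂(F.normalizedHausdorff d) =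
      ((∫ x, re x ∂(F.normalizedHausdorff d) : ℝ) : ℂ) +
        ((∫ x, im x ∂(F.normalizedHausdorff d) : ℝ) : ℂ) * Complex.I :=
    (integral_re_add_im hfint).symm
  rw [hdec]
  push_cast
  ring

/-- Real continuous functions, viewed as complex ones, already determine a finite Borel measure
through their integrals. -/
theorem eq_smul_normalizedHausdorff (hF : F.IsNested lam)
    {d : ℝ} (hd : d = Real.log k / Real.log (1 / lam))
    (ω : GeneralizedLimit) (ν : Measure F.K) [IsFiniteMeasure ν]
    (hν : ∀ f : C(F.K, ℂ), ncIntegral F.dirac ω (F.rep f) = ∫ x, f x ∂ν) :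
    ν = ENNReal.ofReal (1 / Real.log k * ∑ e : F.Edge, e.len ^ d) • F.normalizedHausdorff d := by
  have hprob := hF.isProbabilityMeasure_normalizedHausdorff hd
  have hc : 0 ≤ 1 / Real.log k * ∑ e : F.Edge, e.len ^ d :=
    mul_nonneg (one_div_nonneg.2 hF.log_card_pos.le)
      (Finset.sum_nonneg fun e _ => Real.rpow_nonneg e.len_pos.le _)
  have : IsFiniteMeasure (ENNReal.ofReal (1 / Real.log k * ∑ e : F.Edge, e.len ^ d) •
      F.normalizedHausdorff d) := (F.normalizedHausdorff d).smul_finite ENNReal.ofReal_ne_top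
  refine ext_of_forall_integral_eq_of_IsFiniteMeasure fun f => ?_
  let g : C(F.K, ℂ) := ⟨fun x => (f x : ℂ), Complex.continuous_ofReal.comp f.continuous⟩
  have h1 := (hν g).symm.trans (hF.ncIntegral_rep hd ω g)
  simp only [g, ContinuousMap.coe_mk] at h1
  rw [integral_complex_ofReal, integral_complex_ofReal] at h1
  rw [integral_smul_measure, ENNReal.toReal_ofReal hc, smul_eq_mul]
  exact_mod_cast h1

end IsNested

end SelfSimilarFractal

/-! ### Poles of the zeta function -/

/-- Poles of a quotient of analytic functions whose denominator has only simple zeros. -/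
theorem meromorphicOrderAt_div_neg_iff {f g : ℂ → ℂ} {z : ℂ} (hf : AnalyticAt ℂ f z)
    (hg : AnalyticAt ℂ g z) (hg' : g z = 0 → deriv g z ≠ 0) :
    meromorphicOrderAt (f / g) z < 0 ↔ g z = 0 ∧ f z ≠ 0 := by
  rw [meromorphicOrderAt_div hf.meromorphicAt hg.meromorphicAt, hf.meromorphicOrderAt_eq,
    hg.meromorphicOrderAt_eq]
  by_cases h0 : g z = 0
  · rw [hg.analyticOrderAt_eq_one_of_zero_deriv_ne_zero h0 (hg' h0),
      ← hf.analyticOrderAt_eq_zero]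
    simp only [h0, true_and]
    -- At a simple zero of g the quotient has order m - 1, which is negative only for m = 0; m may
    -- be infinite.
    generalize analyticOrderAt f z = m
    cases m with
    | top => simp
    | coe m =>
      simp only [ENat.map_natCast, ENat.map_one, Nat.cast_one, Nat.cast_eq_zero]
      have h1 : ((m : ℤ) : WithTop ℤ) - ((1 : ℤ) : WithTop ℤ) = ((m - 1 : ℤ) : WithTop ℤ) := rfl
      have h2 : ((m : ℤ) : WithTop ℤ) - ((1 : ℤ) : WithTop ℤ) < ((0 : ℤ) : WithTop ℤ) ↔ m = 0 := by
        rw [h1, WithTop.coe_lt_coe]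
        omega
      exact h2
  · rw [hg.analyticOrderAt_eq_zero.2 h0]
    simp only [h0, false_and, iff_false, not_lt]
    simp

theorem meromorphicOrderAt_div_eq_neg_one {f g : ℂ → ℂ} {z : ℂ} (hf : AnalyticAt ℂ f z)
    (hg : AnalyticAt ℂ g z) (hfz : f z ≠ 0) (hgz : g z = 0) (hg' : deriv g z ≠ 0) :
    meromorphicOrderAt (f / g) z = ((-1 : ℤ) : WithTop ℤ) := by
  rw [meromorphicOrderAt_div hf.meromorphicAt hg.meromorphicAt, hf.meromorphicOrderAt_eq,
    hg.meromorphicOrderAt_eq, hg.analyticOrderAt_eq_one_of_zero_deriv_ne_zero hgz hg',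
    hf.analyticOrderAt_eq_zero.2 hfz]
  rfl

/-- The identity theorem for meromorphic functions that agree on a half plane. -/
theorem Meromorphic.meromorphicOrderAt_eq_of_eqOn_re_gt {f g : ℂ → ℂ} (hf : Meromorphic f)
    (hg : Meromorphic g) {c : ℝ} (h : ∀ s : ℂ, c < s.re → f s = g s) (z : ℂ) :
    meromorphicOrderAt f z = meromorphicOrderAt g z := by
  have hfg : Meromorphic (f - g) := fun x => (hf x).sub (hg x)
  have htop : meromorphicOrderAt (f - g) ((c + 1 : ℝ) : ℂ) = ⊤ := by
    rw [meromorphicOrderAt_eq_top_iff]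
    refine Filter.Eventually.filter_mono nhdsWithin_le_nhds ?_
    have hopen : IsOpen {s : ℂ | c < s.re} := isOpen_lt continuous_const Complex.continuous_re
    filter_upwards [hopen.mem_nhds (by simp : ((c + 1 : ℝ) : ℂ) ∈ {s : ℂ | c < s.re})] with s hs
    rw [Pi.sub_apply, h s hs, sub_self]
  -- Infinite order at one point of the half plane spreads to all of ℂ, so f and g agree on a
  -- punctured neighbourhood of z.
  have hz : meromorphicOrderAt (f - g) z = ⊤ := by
    by_contra hz
    exact hfg.exists_meromorphicOrderAt_ne_top_iff_forall.1 ⟨z, hz⟩ _ htop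
  refine meromorphicOrderAt_congr ?_
  filter_upwards [meromorphicOrderAt_eq_top_iff.1 hz] with s hs
  exact sub_eq_zero.1 hs

namespace SelfSimilarFractal

variable {N k : ℕ} {F : SelfSimilarFractal N k}

theorem analyticAt_edgeSum (z : ℂ) : AnalyticAt ℂ F.edgeSum z := by
  have h : Differentiable ℂ F.edgeSum := by
    unfold edgeSum
    refine Differentiable.fun_sum fun e _ s => ?_
    exact differentiableAt_id.const_cpow (Or.inl (by exact_mod_cast e.len_pos.ne'))
  exact h.analyticAt z

namespace IsNested

variable {lam : ℝ}

theorem hasDerivAt_denom (hF : F.IsNested lam)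
    (z : ℂ) : HasDerivAt (fun s : ℂ => 1 - (k : ℂ) * (lam : ℂ) ^ s)
    (-((k : ℂ) * ((lam : ℂ) ^ z * Complex.log lam))) z := by
  have hl : (lam : ℂ) ≠ 0 := by exact_mod_cast hF.lam_pos.ne'
  have h := (((hasDerivAt_id z).const_cpow (c := (lam : ℂ)) (Or.inl hl)).const_mul
    (k : ℂ)).const_sub
    (1 : ℂ)
  simpa using h

theorem analyticAt_denom (hF : F.IsNested lam) (z : ℂ) :
    AnalyticAt ℂ (fun s : ℂ => 1 - (k : ℂ) * (lam : ℂ) ^ s) z := by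
  have h : Differentiable ℂ (fun s : ℂ => 1 - (k : ℂ) * (lam : ℂ) ^ s) := fun s =>
    (hF.hasDerivAt_denom s).differentiableAt
  exact h.analyticAt z

/-- The derivative is -kλ^z log λ, with log λ < 0. Hence all zeros of the denominator are simple. -/
theorem deriv_denom_ne_zero (hF : F.IsNested lam) (z : ℂ) :
    deriv (fun s : ℂ => 1 - (k : ℂ) * (lam : ℂ) ^ s) z ≠ 0 := by
  have hl : (lam : ℂ) ≠ 0 := by exact_mod_cast hF.lam_pos.ne'
  have hk : (k : ℂ) ≠ 0 := by exact_mod_cast (zero_lt_one.trans hF.one_lt_card).ne'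
  have hlog : Complex.log lam ≠ 0 := by
    rw [← Complex.ofReal_log hF.lam_pos.le]
    exact_mod_cast (Real.log_neg hF.lam_pos hF.lam_lt_one).ne
  rw [(hF.hasDerivAt_denom z).deriv]
  exact neg_ne_zero.2 (mul_ne_zero hk (mul_ne_zero (by simp [Complex.cpow_eq_zero_iff, hl]) hlog))

theorem denom_eq_zero_iff (hF : F.IsNested lam)
    {d : ℝ} (hd : d = Real.log k / Real.log (1 / lam)) (z : ℂ) :
    1 - (k : ℂ) * (lam : ℂ) ^ z = 0 ↔
      ∃ n : ℤ, z = (d : ℂ) * (1 + 2 * Real.pi * Complex.I / (Real.log k : ℂ) * n) := by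
  have hl : (lam : ℂ) ≠ 0 := by exact_mod_cast hF.lam_pos.ne'
  have hk : (0 : ℝ) < k := by exact_mod_cast zero_lt_one.trans hF.one_lt_card
  have hlogk : (Real.log k : ℂ) ≠ 0 := by exact_mod_cast hF.log_card_pos.ne'
  have hlog : (Real.log lam : ℂ) ≠ 0 := by
    exact_mod_cast (Real.log_neg hF.lam_pos hF.lam_lt_one).ne
  have hexp : (k : ℂ) * (lam : ℂ) ^ z = Complex.exp (Real.log k + Real.log lam * z) := by
    rw [Complex.exp_add, ← Complex.ofReal_exp, Real.exp_log hk, Complex.cpow_def_of_ne_zero hl,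
      Complex.ofReal_log hF.lam_pos.le]
    simp
  have hdc : (d : ℂ) = -(Real.log k / Real.log lam) := by
    rw [hd, one_div, Real.log_inv]
    push_cast
    rw [div_neg]
  -- The equation becomes log k + z log λ ∈ 2πiℤ. Since d = -log k / log λ, solving for z reverses
  -- the sign of the integer.
  rw [hexp, sub_eq_zero, eq_comm, Complex.exp_eq_one_iff, hdc]
  clear hexp hdc
  generalize (Real.log k : ℂ) = a at *
  generalize (Real.log lam : ℂ) = b at *
  constructor
  · rintro ⟨n, hn⟩
    refine ⟨-n, ?_⟩
    push_cast
    field_simp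
    linear_combination hn
  · rintro ⟨n, rfl⟩
    refine ⟨-n, ?_⟩
    push_cast
    field_simp
    ring

theorem isMeromorphicExtension (hF : F.IsNested lam)
    {d : ℝ} (hd : d = Real.log k / Real.log (1 / lam)) :
    IsMeromorphicExtension F.dirac
      (fun s : ℂ => F.edgeSum s / (1 - (k : ℂ) * (lam : ℂ) ^ s)) := by
  refine ⟨fun z => (analyticAt_edgeSum z).meromorphicAt.div (hF.analyticAt_denom z).meromorphicAt,
    fun s hs => ?_⟩
  rw [hF.metricDim_dirac hd] at hs
  exact ⟨(hF.isTraceClass_absNegPow_dirac_iff hd ((hF.dim_pos hd).trans hs)).2 hs,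
    hF.zetaFun_dirac hd hs⟩

/-- The definition admits any meromorphic extension; by the identity theorem all of them have the
same orders, so the explicit quotient decides. -/
theorem dimensionSpectrum_eq (hF : F.IsNested lam)
    {d : ℝ} (hd : d = Real.log k / Real.log (1 / lam)) :
    dimensionSpectrum F.dirac =
      {z : ℂ | (∃ n : ℤ, z = (d : ℂ) * (1 + 2 * Real.pi * Complex.I / (Real.log k : ℂ) * n)) ∧
        F.edgeSum z ≠ 0} := by
  have hext := hF.isMeromorphicExtension hd
  have hiff : ∀ z : ℂ,
      meromorphicOrderAt (fun s : ℂ => F.edgeSum s / (1 - (k : ℂ) * (lam : ℂ) ^ s)) z < 0 ↔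
        1 - (k : ℂ) * (lam : ℂ) ^ z = 0 ∧ F.edgeSum z ≠ 0 := fun z =>
    meromorphicOrderAt_div_neg_iff (analyticAt_edgeSum z) (hF.analyticAt_denom z)
      fun _ => hF.deriv_denom_ne_zero z
  ext z
  rw [Set.mem_ofPred_eq, ← hF.denom_eq_zero_iff hd, ← hiff]
  constructor
  · rintro ⟨g, hg, hgz⟩
    rwa [← hg.1.meromorphicOrderAt_eq_of_eqOn_re_gt hext.1
      (fun s hs => (hg.2 s hs).2.symm.trans (hext.2 s hs).2)]
  · exact fun h => ⟨_, hext, h⟩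

/-- At a real exponent the numerator is a nonempty sum of positive numbers. -/
theorem edgeSum_dim_ne_zero (hF : F.IsNested lam) (d : ℝ) : F.edgeSum (d : ℂ) ≠ 0 := by
  have hne := hF.nonempty_edge
  have h : F.edgeSum (d : ℂ) = ((∑ e : F.Edge, e.len ^ d : ℝ) : ℂ) := by
    rw [edgeSum, Complex.ofReal_sum]
    exact Finset.sum_congr rfl fun e _ => (Complex.ofReal_cpow e.len_pos.le d).symm
  rw [h]
  exact_mod_cast (Finset.sum_pos (fun (e : F.Edge) _ => Real.rpow_pos_of_pos e.len_pos d)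
    Finset.univ_nonempty).ne'

theorem meromorphicOrderAt_dim (hF : F.IsNested lam)
    {d : ℝ} (hd : d = Real.log k / Real.log (1 / lam)) :
    meromorphicOrderAt (fun s : ℂ => F.edgeSum s / (1 - (k : ℂ) * (lam : ℂ) ^ s)) (d : ℂ)
      = ((-1 : ℤ) : WithTop ℤ) :=
  meromorphicOrderAt_div_eq_neg_one (analyticAt_edgeSum _) (hF.analyticAt_denom _)
    (hF.edgeSum_dim_ne_zero d) ((hF.denom_eq_zero_iff hd _).2 ⟨0, by simp⟩)
    (hF.deriv_denom_ne_zero _)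

end IsNested

end SelfSimilarFractal

theorem theorem2p3 {N k : ℕ} (F : SelfSimilarFractal N k) (lam : ℝ) (hF : F.IsNested lam)
    (d : ℝ) (hd : d = Real.log k / Real.log (1 / lam)) :
    -- the metric dimension, and the meromorphic extension of the zeta function
    metricDim F.dirac = d ∧
    IsMeromorphicExtension F.dirac (fun s : ℂ => F.edgeSum s / (1 - (k : ℂ) * (lam : ℂ) ^ s)) ∧
    -- the dimension spectrum (points where the numerator vanishes are not poles)
    dimensionSpectrum F.dirac =
      {z : ℂ | (∃ n : ℤ, z = (d : ℂ) * (1 + 2 * Real.pi * Complex.I / (Real.log k : ℂ) * n)) ∧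
        F.edgeSum z ≠ 0} ∧
    -- the pole at `d` is simple
    meromorphicOrderAt (fun s : ℂ => F.edgeSum s / (1 - (k : ℂ) * (lam : ℂ) ^ s)) (d : ℂ)
      = ((-1 : ℤ) : WithTop ℤ) ∧
    -- summability, and the noncommutative integral
    InMacaevIdeal (absNegPow F.dirac (d : ℂ)) ∧
    0 < MeasureTheory.Measure.hausdorffMeasure d F.K ∧
    MeasureTheory.Measure.hausdorffMeasure d F.K < ⊤ ∧
    ∀ ω : GeneralizedLimit,
      (∀ f : C(F.K, ℂ), ncIntegral F.dirac ω (F.rep f) =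
        ((1 / Real.log k * ∑ e : F.Edge, e.len ^ d : ℝ) : ℂ) *
          ∫ x, f x ∂(F.normalizedHausdorff d)) ∧
      -- the measure that represents the functional `f ↦ ∮ f` is this multiple of `H_d`
      ∀ ν : MeasureTheory.Measure F.K, MeasureTheory.IsFiniteMeasure ν →
        (∀ f : C(F.K, ℂ), ncIntegral F.dirac ω (F.rep f) = ∫ x, f x ∂ν) →
        ν = ENNReal.ofReal (1 / Real.log k * ∑ e : F.Edge, e.len ^ d) •
          F.normalizedHausdorff d :=
  ⟨hF.metricDim_dirac hd, hF.isMeromorphicExtension hd, hF.dimensionSpectrum_eq hd,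
    hF.meromorphicOrderAt_dim hd, hF.inMacaevIdeal_absNegPow_dirac hd, hF.hausdorffMeasure_K_pos hd,
    hF.hausdorffMeasure_K_lt_top hd, fun ω => ⟨hF.ncIntegral_rep hd ω, fun ν _ hν =>
      hF.eq_smul_normalizedHausdorff hd ω ν hν⟩⟩
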